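/- Let $k$ be an algebraically closed field of characteristic $p>2$, $X=\mathbb{P}^1_k$ with parameter $t$, $D=d/dt$, $r\ge 3$, $x_1,\dots,x_{r-1}\in k$ pairwise distinct and $x_r=\infty$ (the marked points). *Signatures.* A signature consists of a finite set $M\subset X$ of closed points and numbers $\sigma_x\in\frac1{p-1}\mathbb{Z}_{\ge 0}$, $\sigma_x\ne 1,\frac{p+1}{p-1}$ $(x\in M)$, such that $d=\frac{p-1}{2}\bigl(-2-\sum_{x\in M}(\sigma_x-1)\bigr)$ is a positive integer; put $\sigma_x=1$ for $x\notin M$. Its singularities are the $x\in M$ with $\sigma_x\not\equiv1\pmod p$; assume that they are exactly $x_1,\dots,x_r$. Let $0\le\alpha_i<p$ with $\alpha_i\equiv\sigma_{x_i}\pmod p$ and $Q=\prod_{i<r}(t-x_i)^{1-\alpha_i}$. *Strong accessory parameter problem.* For $\beta_0,\dots,\beta_{r-4}\in k$ let $L=D^2+p_1D+p_2$ with $$p_1=\sum_{i<r}\frac{1-\alpha_i}{t-x_i},\qquad p_2=\frac{d(d-\alpha_r)t^{r-3}-\beta_{r-4}t^{r-4}-\cdots-\beta_0}{\prod_{i<r}(t-x_i)}.$$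 The tuple $(x_i;\beta_j)$ is a solution if $L(u)=0$ for a polynomial $u\in k[t]$ of degree $d$ with simple zeros, none of them in $M$, such that $G:=D^{p-1}\bigl(\frac1{Qu^2}\bigr)\ne0$ and, for $x\in k$, $\operatorname{ord}_xG=(p-1)\sigma_x+\alpha_i-p$ if $x=x_i$, and $\operatorname{ord}_xG=(p-1)(\sigma_x-1)$ if $x$ is not marked (so $\operatorname{ord}_xG=0$ at the zeros of $u$). *Bundles.* A flat bundle is a rank two vector bundle $\mathcal E$ on $X$ with a connection $\nabla$ having at most logarithmic poles at the $x_i$. It is indigenous if the monodromy operator (residue) at each $x_i$ is nonzero and there is a line subbundle $F^1\subset\mathcal E$ (the Hodge filtration) whose Kodaira–Spencer map $F^1\to(\mathcal E/F^1)\otimes\Omega_X(\sum x_i)$ is an isomorphism. Let $\Psi$ be the $p$-curvature, regarded as an $\mathcal{O}_X$-linear map from the $p$-th tensor power of the dual of $\Omega_X(\sum x_i)$ to $\mathcal{E}nd(\mathcal E)$, so that $\Psi(D^{\otimes p})=\nabla(D)^p$. The bundle is active if $\Psi\ne0$, nilpotent if $\Psi$ has nilpotent values, and normalized if there is a horizontal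 surjection $\gamma:\mathcal E\to\mathcal O_X$. The operator $L$ is associated to $(\mathcal E,\nabla)$ if $\nabla(D)^2e_1=-p_2e_1-p_1\nabla(D)e_1$ for an everywhere invertible section $e_1$ of $F^1$ on $\mathbb A^1$. *Deformation data.* A deformation datum is a pair $(Z,\omega)$ of an at most tamely ramified Galois cover $Z\to X$ of smooth projective connected curves and a nonzero rational differential $\omega$ on $Z$ of the form $dy/y$ such that $\operatorname{Gal}(Z/X)$ acts on $\omega$ through an injective character to $\mathbb F_p^\times$. If $(\mathcal E,\nabla)$ is indigenous, active, nilpotent and normalized by $\gamma$, let $e_0$ be the rational section of $F^1$ with $\gamma(e_0)=1$ and let $v\in k(t)$ be given by $\nabla(D)e_0=-v\,\Psi(D^{\otimes p})(e_0)$. The deformation datum $(Z,\omega)$ is attached to $(\mathcal E,\nabla)$ if $\omega=\zeta\,dt$ with $\zeta^{p-1}=v^{-1}$. **Proposition.** Let $(x_i;\beta_j)$ be a solution of the strong accessory parameter problem, with polynomial solution $u$, and let $(\mathcal E,\nabla)$ be an indigenous, active, nilpotent and normalized bundle to which $L$ is associated. For a closed point $x$ let $n_x\ge 0$ be the order of vanishing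 of $\Psi$ at $x$. Then the set of unmarked points with $n_x>0$ is finite; denote it by $\{x_{r+1},\dots,x_s\}$. Write $n_i=n_{x_i}$, let $0\le a_i<p-1$ with $a_i\equiv n_i\pmod{p-1}$, and put $\nu_i=\frac{n_i-a_i}{p-1}$ for $i\le r$ and $\nu_i=1+\frac{n_i-a_i}{p-1}$ for $i>r$. There is a constant $\epsilon\in k^\times$ such that the deformation data attached to $(\mathcal E,\nabla)$ are precisely the pairs $(Z,\omega)$, where $Z\to X$ is (a connected component of) the cover with generic equation $$z^{p-1}=\prod_{1\le i\le s,\ i\neq r}(t-x_i)^{a_i}\,u^2$$ and $$\omega=\frac{\epsilon\,z\,dt}{\prod_{1\le i\le s,\ i\ne r}(t-x_i)^{1-\nu_i}},$$ with $z$ any rational function on $Z$ satisfying this equation and generating $k(Z)$ over $k(t)$. The cover $Z\to X$ is Galois with cyclic group and at most tamely ramified. -/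

import Mathlib

open Polynomial TensorProduct

universe u v w

noncomputable section

namespace AccessoryDatum

/-! ### The projective line: points, local rings, orders, and the derivation `d/dt`

The function field of the projective line over `k` is `RatFunc k`, with standard parameter
`t = RatFunc.X`. The closed points (`k` algebraically closed) are the elements of `OnePoint k`. -/

section Line

variable {k : Type u} [Field k]

/-- The local ring of the projective line at a closed point, as a subring of the function field. -/
def localRing : OnePoint k → Subring (RatFunc k)
  | OnePoint.some a =>
    { carrier := {f | f.denom.eval a ≠ 0}
      zero_mem' := by simp
      one_mem' := by simp
      mul_mem' := by
        intro f g hf hg h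
        obtain ⟨q, hq⟩ := RatFunc.denom_mul_dvd f g
        have := congrArg (Polynomial.eval a) hq
        rw [eval_mul, eval_mul, h, zero_mul] at this
        exact (mul_ne_zero hf hg) this
      add_mem' := by
        intro f g hf hg h
        obtain ⟨q, hq⟩ := RatFunc.denom_add_dvd f g
        have := congrArg (Polynomial.eval a) hq
        rw [eval_mul, eval_mul, h, zero_mul] at this
        exact (mul_ne_zero hf hg) this
      neg_mem' := by
        intro f hf h
        have hd : (-f).denom ∣ f.denom :=
          (RatFunc.denom_dvd f.denom_ne_zero).2 ⟨-f.num, by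
            rw [map_neg, neg_div, RatFunc.num_div_denom]⟩
        have hd' : f.denom ∣ (-f).denom :=
          (RatFunc.denom_dvd (-f).denom_ne_zero).2 ⟨-(-f).num, by
            rw [map_neg, neg_div, RatFunc.num_div_denom, neg_neg]⟩
        obtain ⟨q, hq⟩ := hd'
        obtain ⟨q', hq'⟩ := hd
        have := congrArg (Polynomial.eval a) hq'
        rw [eval_mul, h, zero_mul] at this
        exact hf this }
  | OnePoint.infty =>
    { carrier := {f | f.intDegree ≤ 0}
      zero_mem' := by simp
      one_mem' := by simp
      mul_mem' := by
        intro f g hf hg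
        simp only [Set.mem_ofPred_eq] at *
        by_cases h1 : f = 0
        · simp [h1]
        by_cases h2 : g = 0
        · simp [h2]
        rw [RatFunc.intDegree_mul h1 h2]
        omega
      add_mem' := by
        intro f g hf hg
        simp only [Set.mem_ofPred_eq] at *
        by_cases h2 : g = 0
        · simpa [h2] using hf
        by_cases h3 : f + g = 0
        · simp [h3]
        exact (RatFunc.intDegree_add_le h2 h3).trans (max_le hf hg)
      neg_mem' := by
        intro f hf
        simpa using hf }

/-- A local parameter at a closed point: `t - a` at `a`, and `1/t` at infinity. -/
def localParam : OnePoint k → RatFunc k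
  | OnePoint.some a => RatFunc.X - RatFunc.C a
  | OnePoint.infty => RatFunc.X⁻¹

/-- The order of vanishing of a nonzero rational function at the finite point `a`. -/
def ordAt (a : k) (f : RatFunc k) : ℤ :=
  (f.num.rootMultiplicity a : ℤ) - (f.denom.rootMultiplicity a : ℤ)

/-- The function underlying the derivation `d/dt` of `k(t)` (quotient rule). -/
def ddtFun (f : RatFunc k) : RatFunc k :=
  algebraMap k[X] (RatFunc k) (derivative f.num * f.denom - f.num * derivative f.denom) /
    algebraMap k[X] (RatFunc k) f.denom ^ 2

theorem ddtFun_div (a b : k[X]) (hb : b ≠ 0) :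
    ddtFun (algebraMap k[X] (RatFunc k) a / algebraMap k[X] (RatFunc k) b) =
      algebraMap k[X] (RatFunc k) (derivative a * b - a * derivative b) /
        algebraMap k[X] (RatFunc k) b ^ 2 := by
  set f := algebraMap k[X] (RatFunc k) a / algebraMap k[X] (RatFunc k) b with hf
  have hb' : algebraMap k[X] (RatFunc k) b ≠ 0 := RatFunc.algebraMap_ne_zero hb
  have hd : f.denom ≠ 0 := f.denom_ne_zero
  have hd' : algebraMap k[X] (RatFunc k) f.denom ≠ 0 := RatFunc.algebraMap_ne_zero hd
  have h1 : f.num * b = a * f.denom := by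
    apply RatFunc.algebraMap_injective k
    have h := f.num_div_denom
    rw [hf, div_eq_div_iff hd' hb'] at h
    rw [map_mul, map_mul]
    exact h
  have h2 : derivative f.num * b + f.num * derivative b =
      derivative a * f.denom + a * derivative f.denom := by
    rw [← derivative_mul, ← derivative_mul, h1]
  unfold ddtFun
  rw [div_eq_div_iff (pow_ne_zero 2 hd') (pow_ne_zero 2 hb'), ← map_pow, ← map_pow, ← map_mul,
    ← map_mul]
  congr 1
  linear_combination (b * f.denom) * h2 - (b * derivative f.denom + f.denom * derivative b) * h1

/-- The derivation `d/dt` of the function field `k(t)`. -/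
def ddt : Derivation k (RatFunc k) (RatFunc k) where
  toFun := ddtFun
  map_add' := by
    intro f g
    have hf : algebraMap k[X] (RatFunc k) f.denom ≠ 0 :=
      RatFunc.algebraMap_ne_zero f.denom_ne_zero
    have hg : algebraMap k[X] (RatFunc k) g.denom ≠ 0 :=
      RatFunc.algebraMap_ne_zero g.denom_ne_zero
    have h : f + g = algebraMap k[X] (RatFunc k) (f.num * g.denom + g.num * f.denom) /
        algebraMap k[X] (RatFunc k) (f.denom * g.denom) := by
      conv_lhs => rw [← f.num_div_denom, ← g.num_div_denom]
      simp only [map_add, map_mul]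
      field_simp
    rw [h, ddtFun_div _ _ (mul_ne_zero f.denom_ne_zero g.denom_ne_zero)]
    unfold ddtFun
    simp only [map_add, derivative_mul, map_mul, map_sub]
    field_simp
    ring
  map_smul' := by
    intro c f
    have hf : algebraMap k[X] (RatFunc k) f.denom ≠ 0 :=
      RatFunc.algebraMap_ne_zero f.denom_ne_zero
    have h : c • f = algebraMap k[X] (RatFunc k) (C c * f.num) /
        algebraMap k[X] (RatFunc k) f.denom := by
      conv_lhs => rw [← f.num_div_denom]
      rw [map_mul, RatFunc.algebraMap_C, mul_div_assoc, RatFunc.smul_eq_C_mul]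
    simp only [RingHom.id_apply]
    rw [h, ddtFun_div _ _ f.denom_ne_zero]
    unfold ddtFun
    rw [RatFunc.smul_eq_C_mul]
    simp only [derivative_mul, derivative_C, zero_mul, zero_add, map_mul, map_sub,
      RatFunc.algebraMap_C]
    field_simp
  map_one_eq_zero' := by
    change ddtFun 1 = 0
    simp [ddtFun]
  leibniz' := by
    intro f g
    change ddtFun (f * g) = f • ddtFun g + g • ddtFun f
    have hf : algebraMap k[X] (RatFunc k) f.denom ≠ 0 :=
      RatFunc.algebraMap_ne_zero f.denom_ne_zero
    have hg : algebraMap k[X] (RatFunc k) g.denom ≠ 0 :=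
      RatFunc.algebraMap_ne_zero g.denom_ne_zero
    have h : f * g = algebraMap k[X] (RatFunc k) (f.num * g.num) /
        algebraMap k[X] (RatFunc k) (f.denom * g.denom) := by
      conv_lhs => rw [← f.num_div_denom, ← g.num_div_denom]
      simp only [map_mul]
      field_simp
    have hf2 : f = algebraMap k[X] (RatFunc k) f.num / algebraMap k[X] (RatFunc k) f.denom :=
      f.num_div_denom.symm
    have hg2 : g = algebraMap k[X] (RatFunc k) g.num / algebraMap k[X] (RatFunc k) g.denom :=
      g.num_div_denom.symm
    rw [h, ddtFun_div _ _ (mul_ne_zero f.denom_ne_zero g.denom_ne_zero)]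
    have e : f • ddtFun g + g • ddtFun f =
        (algebraMap k[X] (RatFunc k) f.num / algebraMap k[X] (RatFunc k) f.denom) * ddtFun g +
        (algebraMap k[X] (RatFunc k) g.num / algebraMap k[X] (RatFunc k) g.denom) * ddtFun f := by
      rw [← hf2, ← hg2, smul_eq_mul, smul_eq_mul]
    rw [e]
    unfold ddtFun
    simp only [derivative_mul, map_add, map_mul, map_sub]
    field_simp
    ring

theorem ddt_X : ddt (RatFunc.X : RatFunc k) = 1 := by
  change ddtFun RatFunc.X = 1
  have h := ddtFun_div (k := k) X 1 one_ne_zero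
  simpa using h

/-- In characteristic `p` the `p`-th iterate of `d/dt` is zero. -/
theorem ddt_iterate_p (p : ℕ) [Fact p.Prime] [CharP k p] (f : RatFunc k) :
    (ddt : Derivation k (RatFunc k) (RatFunc k))^[p] f = 0 := by
  have hp : p.Prime := Fact.out
  have hch : CharP (RatFunc k) p := charP_of_injective_algebraMap (algebraMap k _).injective p
  have hpow : ∀ g : RatFunc k, (ddt : Derivation k (RatFunc k) (RatFunc k)) (g ^ p) = 0 := by
    intro g
    rw [Derivation.leibniz_pow, ← Nat.cast_smul_eq_nsmul (RatFunc k), CharP.cast_eq_zero, zero_smul]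
  have hlin : ∀ (n : ℕ) (g h : RatFunc k), (ddt : Derivation k (RatFunc k) (RatFunc k)) g = 0 →
      (ddt : Derivation k (RatFunc k) (RatFunc k))^[n] (g * h) =
        g * (ddt : Derivation k (RatFunc k) (RatFunc k))^[n] h := by
    intro n
    induction n with
    | zero => intro g h _; rfl
    | succ n ih =>
      intro g h hg
      rw [Function.iterate_succ_apply, Function.iterate_succ_apply, Derivation.leibniz, hg,
        smul_zero, add_zero, smul_eq_mul, ih _ _ hg]
  have hpoly1 : ∀ a : k[X], (ddt : Derivation k (RatFunc k) (RatFunc k))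
      (algebraMap k[X] (RatFunc k) a) = algebraMap k[X] (RatFunc k) (derivative a) := by
    intro a
    have h := ddtFun_div a 1 one_ne_zero
    rw [map_one, div_one] at h
    change ddtFun _ = _
    rw [h]
    simp
  have hpoly : ∀ (n : ℕ) (a : k[X]), (ddt : Derivation k (RatFunc k) (RatFunc k))^[n]
      (algebraMap k[X] (RatFunc k) a) = algebraMap k[X] (RatFunc k) (derivative^[n] a) := by
    intro n
    induction n with
    | zero => intro a; rfl
    | succ n ih => intro a; rw [Function.iterate_succ_apply, Function.iterate_succ_apply, hpoly1, ih]
  have hzero : ∀ a : k[X], derivative^[p] a = 0 := by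
    intro a
    ext n
    rw [coeff_iterate_derivative, coeff_zero, ← Nat.cast_smul_eq_nsmul k,
      (CharP.cast_eq_zero_iff k p _).2, zero_smul]
    exact (Nat.dvd_factorial hp.pos le_rfl).trans (Nat.factorial_dvd_descFactorial _ _)
  have hd : algebraMap k[X] (RatFunc k) f.denom ≠ 0 :=
    RatFunc.algebraMap_ne_zero f.denom_ne_zero
  have hf : f = (algebraMap k[X] (RatFunc k) f.denom)⁻¹ ^ p *
      algebraMap k[X] (RatFunc k) (f.num * f.denom ^ (p - 1)) := by
    have h := f.num_div_denom
    have hs : (algebraMap k[X] (RatFunc k) f.denom) ^ p =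
        (algebraMap k[X] (RatFunc k) f.denom) ^ (p - 1) * algebraMap k[X] (RatFunc k) f.denom := by
      rw [← pow_succ, Nat.sub_add_cancel hp.one_le]
    conv_lhs => rw [← h]
    rw [map_mul, map_pow, inv_pow, hs]
    field_simp
  rw [hf, hlin _ _ _ (hpow _), hpoly, hzero, map_zero, mul_zero]

end Line

/-! ### Flat bundles of rank two on the projective line with marked points -/

section Bundles

variable {k : Type u} [Field k]

open Classical in
/-- For a set `S` of marked points, the vector field `logCoeff S x · d/dt` generates, near `x`, the
vector fields that vanish at the marked points. With `s` the local parameter `localParam x` it is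
`s · d/ds` if `x` is marked and `d/ds` otherwise (note `d/ds = -t² · d/dt` for `s = 1/t`). -/
def logCoeff (S : Set (OnePoint k)) : OnePoint k → RatFunc k
  | OnePoint.some a => if (OnePoint.some a) ∈ S then RatFunc.X - RatFunc.C a else 1
  | OnePoint.infty => if OnePoint.infty ∈ S then -RatFunc.X else -RatFunc.X ^ 2

/-- A flat vector bundle of rank two on the projective line, with logarithmic poles in the set `S`
of marked points. The bundle is given by its generic fibre `V` and its stalks, a family of lattices
in `V` almost all of which are spanned by one basis of `V`. The connection is given on the
generic fibre by the operator `nabla = ∇(d/dt)`; thus `∇(g · d/dt) = g · nabla`. -/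
structure FlatBundle (S : Set (OnePoint k)) (V : Type v) [AddCommGroup V]
    [Module (RatFunc k) V] where
  stalk : ∀ x : OnePoint k, Submodule (localRing x) V
  exists_frame : ∀ x, ∃ b : Module.Basis (Fin 2) (RatFunc k) V,
    stalk x = Submodule.span (localRing x) (Set.range b)
  exists_generic_frame : ∃ b : Module.Basis (Fin 2) (RatFunc k) V,
    {x | stalk x ≠ Submodule.span (localRing x) (Set.range b)}.Finite
  nabla : V →+ V
  leibniz : ∀ (f : RatFunc k) (e : V), nabla (f • e) = ddt f • e + f • nabla e
  regular : ∀ x, ∀ e ∈ stalk x, logCoeff S x • nabla e ∈ stalk x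

namespace FlatBundle

variable {S : Set (OnePoint k)} {V : Type v} [AddCommGroup V] [Module (RatFunc k) V]

/-- The monodromy operator at `x`, i.e. the endomorphism of the fibre `E_x / m_x E_x` induced by
`∇(s · d/ds)`, is not zero. -/
def NontrivialMonodromy (E : FlatBundle S V) (x : OnePoint k) : Prop :=
  ∃ e ∈ E.stalk x, ¬ ∃ e' ∈ E.stalk x, logCoeff S x • E.nabla e = localParam x • e'

/-- `L` (the generic fibre of a line subbundle, whose stalk at `x` is `L ∩ E_x`) is a Hodge
filtration: at each point the Kodaira-Spencer map `L ∩ E_x → E_x / (L ∩ E_x)`, which sends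
`e` to the class of `∇(θ) e` with `θ` the generator of the logarithmic vector fields at `x`, is
injective and surjective. -/
def IsHodgeFiltration (E : FlatBundle S V) (L : Submodule (RatFunc k) V) : Prop :=
  Module.finrank (RatFunc k) L = 1 ∧
  ∀ x : OnePoint k,
    (∀ e ∈ L, e ∈ E.stalk x → logCoeff S x • E.nabla e ∈ L → e = 0) ∧
    (∀ e ∈ E.stalk x, ∃ e₁ ∈ L, e₁ ∈ E.stalk x ∧ e - logCoeff S x • E.nabla e₁ ∈ L)

/-- Indigenous bundles. -/
def IsIndigenous (E : FlatBundle S V) : Prop :=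
  (∃ L, E.IsHodgeFiltration L) ∧ ∀ x ∈ S, E.NontrivialMonodromy x

/-- The value `∇(D)^p - ∇(D^p)` of the `p`-curvature at `D^{⊗p}`, `D = d/dt`; here `D^p = 0`
(see `ddt_iterate_p`). The `p`-curvature is linear over the function field, so its value
at `(g · D)^{⊗p} = g^p · D^{⊗p}` is `g^p • pCurvature`. -/
def pCurvature (E : FlatBundle S V) (p : ℕ) (e : V) : V :=
  E.nabla^[p] e

/-- The `p`-curvature is not zero. -/
def IsActive (E : FlatBundle S V) (p : ℕ) : Prop :=
  ∃ e, E.pCurvature p e ≠ 0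

/-- The `p`-curvature takes nilpotent values. -/
def IsNilpotent (E : FlatBundle S V) (p : ℕ) : Prop :=
  ∃ n : ℕ, ∀ e, (E.pCurvature p)^[n] e = 0

/-- `γ` is a horizontal surjective homomorphism from the bundle to the structure sheaf. -/
def IsNormalization (E : FlatBundle S V) (γ : V →ₗ[RatFunc k] RatFunc k) : Prop :=
  (∀ e, γ (E.nabla e) = ddt (γ e)) ∧
  ∀ x, (γ '' (E.stalk x : Set V)) = (localRing x : Set (RatFunc k))

/-- A normalized bundle: it has a horizontal surjection to the structure sheaf. -/
def IsNormalized (E : FlatBundle S V) : Prop :=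
  ∃ γ, E.IsNormalization γ

/-- The order of vanishing at `x` of the `p`-curvature, as a map from the `p`-th tensor power of
the logarithmic tangent sheaf to the endomorphisms of the bundle. The points where it is positive
are the spikes. -/
def spikeOrder (E : FlatBundle S V) (p : ℕ) (x : OnePoint k) : ℕ :=
  sSup {n : ℕ | ∀ e ∈ E.stalk x, ∃ e' ∈ E.stalk x,
    logCoeff S x ^ p • E.pCurvature p e = localParam x ^ n • e'}

/-- The operator `(d/dt)² + P₁ (d/dt) + P₂` is associated to the bundle with Hodge filtration `L`:
for a section `e₁` of the Hodge filtration that is invertible on the whole affine line, and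
`e₂ = ∇(d/dt) e₁`, one has `∇(d/dt) e₂ = - P₂ e₁ - P₁ e₂`. -/
def IsAssociatedOperator (E : FlatBundle S V) (L : Submodule (RatFunc k) V)
    (P₁ P₂ : RatFunc k) : Prop :=
  ∃ e₁ ∈ L,
    (∀ a : k, ∀ e : V, (e ∈ L ∧ e ∈ E.stalk (OnePoint.some a)) ↔
      ∃ f ∈ localRing (OnePoint.some a), e = f • e₁) ∧
    E.nabla (E.nabla e₁) = -(P₂ • e₁) - P₁ • E.nabla e₁

end FlatBundle

end Bundles

/-! ### Deformation data -/

section Data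

variable (k : Type u) [Field k] (F : Type w) [Field F] [Algebra k F]

theorem ideal_le_comap (s : F →ₐ[k] F) :
    KaehlerDifferential.ideal k F ≤
      (KaehlerDifferential.ideal k F).comap (Algebra.TensorProduct.map s s) := by
  rw [← KaehlerDifferential.span_range_eq_ideal, Ideal.span_le]
  rintro _ ⟨f, rfl⟩
  simp only [SetLike.mem_coe, Ideal.mem_comap, map_sub, Algebra.TensorProduct.map_tmul, map_one]
  exact Ideal.subset_span ⟨s f, rfl⟩

/-- The map `a db ↦ s(a) d(s(b))` induced on the differentials of `F/k` by an endomorphism `s`. -/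
def pullback (s : F →ₐ[k] F) : Ω[F⁄k] →ₗ[k] Ω[F⁄k] :=
  Ideal.mapCotangent (KaehlerDifferential.ideal k F) (KaehlerDifferential.ideal k F)
    (Algebra.TensorProduct.map s s) (ideal_le_comap k F s)

theorem pullback_smul_D (s : F →ₐ[k] F) (a b : F) :
    pullback k F s (a • KaehlerDifferential.D k F b) = s a • KaehlerDifferential.D k F (s b) := by
  have key : ∀ a b : F, ∃ h : a ⊗ₜ[k] b - (a * b) ⊗ₜ[k] (1 : F) ∈ KaehlerDifferential.ideal k F,
      a • KaehlerDifferential.D k F b =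
        (KaehlerDifferential.ideal k F).toCotangent ⟨a ⊗ₜ[k] b - (a * b) ⊗ₜ[k] (1 : F), h⟩ := by
    intro a b
    have e : a ⊗ₜ[k] b - (a * b) ⊗ₜ[k] (1 : F) =
        (a ⊗ₜ[k] (1 : F)) • ((1 : F) ⊗ₜ[k] b - b ⊗ₜ[k] (1 : F)) := by
      rw [smul_eq_mul, mul_sub, Algebra.TensorProduct.tmul_mul_tmul,
        Algebra.TensorProduct.tmul_mul_tmul, mul_one, one_mul, one_mul]
    refine ⟨?_, ?_⟩
    · rw [e]
      exact (KaehlerDifferential.ideal k F).smul_mem _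
        (KaehlerDifferential.one_smul_sub_smul_one_mem_ideal k b)
    · rw [← algebraMap_smul (F ⊗[k] F) a (KaehlerDifferential.D k F b)]
      change (a ⊗ₜ[k] (1 : F)) • (KaehlerDifferential.ideal k F).toCotangent
        ⟨(1 : F) ⊗ₜ[k] b - b ⊗ₜ[k] (1 : F),
          KaehlerDifferential.one_smul_sub_smul_one_mem_ideal k b⟩ = _
      rw [← map_smul]
      congr 1
      exact Subtype.ext e.symm
  obtain ⟨h, e⟩ := key a b
  obtain ⟨h', e'⟩ := key (s a) (s b)
  rw [e, e']
  unfold pullback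
  erw [Ideal.mapCotangent_toCotangent]
  congr 2
  simp

variable [Algebra (RatFunc k) F] [IsScalarTower k (RatFunc k) F]

/-- The differential `dt` on `F`. -/
def dt : Ω[F⁄k] := KaehlerDifferential.D k F (algebraMap (RatFunc k) F RatFunc.X)

/-- For a Galois extension `F` of `k(t)` with `k` algebraically closed of characteristic `p`: the
corresponding cover of curves is at most tamely ramified. Points of the cover are the nontrivial
valuation subrings of `F` over `k`; their residue fields are `k`, so the order of the stabilizer of
a point is its ramification index. -/
def IsTame (p : ℕ) : Prop :=
  ∀ A : ValuationSubring F, A ≠ ⊤ → (∀ c : k, algebraMap k F c ∈ A) →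
    (Nat.card (A.decompositionSubgroup (RatFunc k))).Coprime p

variable {F}

/-- A deformation datum on the projective line: a (connected, at most tamely ramified) Galois cover,
given by its function field `F`, with a nonzero logarithmic rational differential form on which
the Galois group acts through an injective character with values in `F_p^×`. -/
structure IsDeformationDatum (p : ℕ) (ω : Ω[F⁄k]) : Prop where
  finite : FiniteDimensional (RatFunc k) F
  galois : IsGalois (RatFunc k) F
  tame : IsTame k F p
  ne_zero : ω ≠ 0
  character : ∃ χ : (F ≃ₐ[RatFunc k] F) →* (ZMod p)ˣ, Function.Injective χ ∧
    ∀ s : F ≃ₐ[RatFunc k] F,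
      pullback k F ((s : F →ₐ[RatFunc k] F).restrictScalars k) ω =
        (((χ s : (ZMod p)ˣ) : ZMod p).cast : F) • ω
  logarithmic : ∃ y : F, y ≠ 0 ∧ ω = y⁻¹ • KaehlerDifferential.D k F y

variable {k}

/-- The deformation datum `(F, ω)` is attached to the (indigenous, active, nilpotent, normalized)
bundle `E` with Hodge filtration `L`. Let `γ` be a horizontal surjection to the structure sheaf and `e₀` the canonical section:
the rational section of the Hodge filtration with `γ(e₀) = 1`. The kernel of `γ` is
identified with a twist of the `p`-th power of the logarithmic tangent sheaf by the rule
`Ψ(D^{⊗p})(e) = -γ(e) D^{⊗p}`, so that `D^{⊗p}` is the section `-Ψ(D^{⊗p})(e₀)`. Then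
`∇(e₀) = v · D^{⊗(p-1)}` for a rational function `v`, i.e. `∇(D) e₀ = v · D^{⊗p}`, and the condition
is that `ω^{⊗(1-p)} = v · D^{⊗(p-1)}`, i.e. `ω = ζ dt` with `ζ^{p-1} = v⁻¹`. -/
def IsAttached (p : ℕ) {S : Set (OnePoint k)} {V : Type v} [AddCommGroup V] [Module (RatFunc k) V]
    (E : FlatBundle S V) (L : Submodule (RatFunc k) V) (ω : Ω[F⁄k]) : Prop :=
  IsDeformationDatum k p ω ∧
  ∃ (γ : V →ₗ[RatFunc k] RatFunc k) (e₀ : V) (v : RatFunc k) (ζ : F),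
    E.IsNormalization γ ∧ e₀ ∈ L ∧ γ e₀ = 1 ∧
    E.nabla e₀ = v • (-E.pCurvature p e₀) ∧
    ω = ζ • dt k F ∧ ζ ^ (p - 1) * algebraMap (RatFunc k) F v = 1

/-- `F` is the function field of (a connected component of) the cover of the projective line with
generic equation `z^(p-1) = f`. -/
def IsKummerCover (p : ℕ) (f : RatFunc k) (z : F) : Prop :=
  IntermediateField.adjoin (RatFunc k) {z} = ⊤ ∧ z ^ (p - 1) = algebraMap (RatFunc k) F f

end Data

/-! ### The strong accessory parameter problem -/

section Accessory

/-- A signature on the projective line in characteristic `p`: a finite set `M` of points and numbers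
`σ_x = num x / (p - 1) ≥ 0`, different from `1` and `(p+1)/(p-1)`, such that
`d = (p-1)/2 · (-2 - ∑_{x ∈ M} (σ_x - 1))` is a positive integer. -/
structure Signature (k : Type u) (p : ℕ) where
  M : Finset (OnePoint k)
  num : OnePoint k → ℕ
  num_ne : ∀ x ∈ M, num x ≠ p - 1 ∧ num x ≠ p + 1
  d : ℕ
  d_pos : 0 < d
  two_d : 2 * (d : ℤ) = -2 * ((p : ℤ) - 1) - ∑ x ∈ M, ((num x : ℤ) - ((p : ℤ) - 1))

variable {k : Type u} {p : ℕ}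

/-- The singularities of a signature: the `x ∈ M` with `σ_x ≢ 1 (mod p)`. -/
def Signature.IsSingularity (σ : Signature k p) (x : OnePoint k) : Prop :=
  x ∈ σ.M ∧ ¬ (σ.num x : ℤ) ≡ -1 [ZMOD p]

/-- The integer `0 ≤ α_x < p` with `α_x ≡ σ_x (mod p)`; as `1/(p-1) ≡ -1`, this says
`α_x ≡ - num x (mod p)`. -/
def Signature.alpha (σ : Signature k p) (x : OnePoint k) : ℕ :=
  ((-(σ.num x : ℤ)) % (p : ℤ)).toNat

variable [Field k] {r : ℕ}

/-- The marked points: `x_1, …, x_{r-1}` and `x_r = ∞`. -/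
def marked (x : Fin (r - 1) → k) : Set (OnePoint k) :=
  {y | y = OnePoint.infty ∨ ∃ i, y = OnePoint.some (x i)}

/-- The coefficient `p₁ = ∑_{i<r} (1 - α_i)/(t - x_i)`. -/
def coeffP1 (σ : Signature k p) (x : Fin (r - 1) → k) : RatFunc k :=
  ∑ i, RatFunc.C (1 - (σ.alpha (OnePoint.some (x i)) : k)) / (RatFunc.X - RatFunc.C (x i))

/-- The coefficient
`p₂ = (d (d - α_r) t^{r-3} - β_{r-4} t^{r-4} - ⋯ - β_0) / ∏_{i<r} (t - x_i)`. -/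
def coeffP2 (σ : Signature k p) (x : Fin (r - 1) → k) (β : Fin (r - 3) → k) : RatFunc k :=
  (RatFunc.C ((σ.d : k) * ((σ.d : k) - (σ.alpha OnePoint.infty : k))) * RatFunc.X ^ (r - 3) -
      ∑ j, RatFunc.C (β j) * RatFunc.X ^ (j : ℕ)) /
    ∏ i, (RatFunc.X - RatFunc.C (x i))

/-- `Q = ∏_{i<r} (t - x_i)^{1 - α_i}`. -/
def funQ (σ : Signature k p) (x : Fin (r - 1) → k) : RatFunc k :=
  ∏ i, (RatFunc.X - RatFunc.C (x i)) ^ (1 - (σ.alpha (OnePoint.some (x i)) : ℤ))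

/-- `(x; β)` is a solution of the strong accessory parameter problem with signature `σ`, and `u` is
the polynomial solution of the differential equation. The order of `(d/dt)^{p-1} (1/(Q u²))` is
prescribed at the finite points; at infinity it is then determined, since the degree of the
divisor of a rational function is zero. -/
structure IsStrongSolution (σ : Signature k p) (x : Fin (r - 1) → k) (β : Fin (r - 3) → k)
    (u : k[X]) : Prop where
  injective : Function.Injective x
  singularity : ∀ y, σ.IsSingularity y ↔ y ∈ marked x
  degree : u.natDegree = σ.d
  simple_zeros : ∀ a, u.rootMultiplicity a ≤ 1
  equation : ddt (ddt (algebraMap k[X] (RatFunc k) u)) +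
    coeffP1 σ x * ddt (algebraMap k[X] (RatFunc k) u) +
    coeffP2 σ x β * algebraMap k[X] (RatFunc k) u = 0
  eval_ne_zero : ∀ a, OnePoint.some a ∈ σ.M → u.eval a ≠ 0
  active : (ddt : Derivation k (RatFunc k) (RatFunc k))^[p - 1]
    (funQ σ x * algebraMap k[X] (RatFunc k) u ^ 2)⁻¹ ≠ 0
  ord_marked : ∀ i, ordAt (x i) ((ddt : Derivation k (RatFunc k) (RatFunc k))^[p - 1]
    (funQ σ x * algebraMap k[X] (RatFunc k) u ^ 2)⁻¹) =
      (σ.num (OnePoint.some (x i)) : ℤ) + σ.alpha (OnePoint.some (x i)) - p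
  ord_other : ∀ a, OnePoint.some a ∈ σ.M → (∀ i, a ≠ x i) →
    ordAt a ((ddt : Derivation k (RatFunc k) (RatFunc k))^[p - 1]
      (funQ σ x * algebraMap k[X] (RatFunc k) u ^ 2)⁻¹) =
      (σ.num (OnePoint.some a) : ℤ) - ((p : ℤ) - 1)
  ord_else : ∀ a, OnePoint.some a ∉ σ.M →
    ordAt a ((ddt : Derivation k (RatFunc k) (RatFunc k))^[p - 1]
      (funQ σ x * algebraMap k[X] (RatFunc k) u ^ 2)⁻¹) = 0

variable {V : Type v} [AddCommGroup V] [Module (RatFunc k) V]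

/-- The right-hand side `∏_{i ≠ r} (t - x_i)^{a_i} · u²` of the generic equation. The product is over
the finite marked points and the set `spk` of unmarked spikes, and `0 ≤ a_i < p - 1` is
the residue modulo `p - 1` of the order `n_i` of the `p`-curvature. -/
def radicand (p : ℕ) (x : Fin (r - 1) → k) (E : FlatBundle (marked x) V) (spk : Finset k)
    (u : k[X]) : RatFunc k :=
  (∏ i, (RatFunc.X - RatFunc.C (x i)) ^ (E.spikeOrder p (OnePoint.some (x i)) % (p - 1))) *
    (∏ b ∈ spk, (RatFunc.X - RatFunc.C b) ^ (E.spikeOrder p (OnePoint.some b) % (p - 1))) *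
    algebraMap k[X] (RatFunc k) u ^ 2

/-- The denominator `∏_{i ≠ r} (t - x_i)^{1 - ν_i}`, with `ν_i = (n_i - a_i)/(p - 1)` at the marked
points and `ν_i = 1 + (n_i - a_i)/(p - 1)` at the other spikes. -/
def formDenom (p : ℕ) (x : Fin (r - 1) → k) (E : FlatBundle (marked x) V) (spk : Finset k) :
    RatFunc k :=
  (∏ i, (RatFunc.X - RatFunc.C (x i)) ^
      (1 - ((E.spikeOrder p (OnePoint.some (x i)) / (p - 1) : ℕ) : ℤ))) *
    ∏ b ∈ spk, (RatFunc.X - RatFunc.C b) ^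
      (1 - ((1 + E.spikeOrder p (OnePoint.some b) / (p - 1) : ℕ) : ℤ))

end Accessory

end AccessoryDatum

end

/-!
Write `K = k(t)`, `D = d/dt`, `Ψ = ∇(D)^p`, and let `e₁` generate the Hodge filtration on the affine
line.

Let `γ` be a normalization. Since `D^p = 0` on `K`, the values of `Ψ` lie in `ker γ`, and as `Ψ` is
nilpotent it kills this line; thus `Ψ(e) = γ(e) η` with `η = Ψ(e₀)` horizontal, and `∇ e₀ = -v η`.
Applying `∇^{p-1}` gives `D^{p-1} v = -1` (`FlatBundle.iterate_ddt_eq_neg_one`). The polynomial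
solution `u` defines a second horizontal functional, which also kills `η`; therefore `γ(e₁) / u` is
a constant of `D`. The bundle is generated near a finite point by `e₁` and its logarithmic
derivative (Kodaira-Spencer), so surjectivity of `γ` on stalks bounds the zeros of `γ(e₁)`, and
`γ(e₁) = c u` with `c ∈ k` (`exists_apply_eq_const_mul`). The differential equation says that
`v Q u²` is a constant of `D`, so `v Q u² · D^{p-1}(1 / (Q u²)) = -1` (`coeff_mul_eq_neg_one`). In
particular `v` does not depend on `γ`, and its order at every finite point is prescribed by the
strong accessory parameter problem. The order of `η` in the stalks gives the orders `n_x` of the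
`p`-curvature (`FlatBundle.mem_spikeOrder_set_iff`). Comparing orders at all finite points shows
that `v⁻¹` is a constant times the radicand of the generic equation divided by the `(p-1)`-st power
of the denominator of the form (`exists_inv_coeff_eq`); `ε` is a `(p-1)`-st root of the constant.

Hence `ζ^{p-1} = v⁻¹` is the generic equation for `z`, up to scaling. If `ζ dt` belongs to a
deformation datum, then `ζ` generates the cover, because the Galois group acts faithfully on the
form. Conversely, the cover generated by `ζ` is a Kummer cover of exponent `p - 1`, as
`𝔽_p^× ⊂ k`, hence cyclic and tame. The form `ζ dt` is logarithmic by Jacobson's formula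
`(D + h)^p = D^p + D^{p-1}(h) + h^p` (`jacobson_formula`): as `ζ = ζ^p v` with `ζ^p` a constant of
`D`, we have `D^{p-1} ζ = -ζ^p`, so `D - ζ` is nilpotent and `D y = ζ y` has a nonzero solution.
-/

namespace AccessoryDatum

/-! ### Orders of rational functions at the finite points -/

section Orders

variable {k : Type u} [Field k]

theorem ordAt_div (a : k) {P Q : k[X]} (hP : P ≠ 0) (hQ : Q ≠ 0) :
    ordAt a (algebraMap k[X] (RatFunc k) P / algebraMap k[X] (RatFunc k) Q) =
      (P.rootMultiplicity a : ℤ) - Q.rootMultiplicity a := by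
  set f := algebraMap k[X] (RatFunc k) P / algebraMap k[X] (RatFunc k) Q with hf
  have hP' : algebraMap k[X] (RatFunc k) P ≠ 0 := RatFunc.algebraMap_ne_zero hP
  have hQ' : algebraMap k[X] (RatFunc k) Q ≠ 0 := RatFunc.algebraMap_ne_zero hQ
  have hf0 : f ≠ 0 := div_ne_zero hP' hQ'
  have hn : f.num ≠ 0 := RatFunc.num_ne_zero hf0
  have hd : f.denom ≠ 0 := f.denom_ne_zero
  have hd' : algebraMap k[X] (RatFunc k) f.denom ≠ 0 := RatFunc.algebraMap_ne_zero hd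
  have h1 : f.num * Q = P * f.denom := by
    apply RatFunc.algebraMap_injective k
    have h := f.num_div_denom
    rw [hf, div_eq_div_iff hd' hQ'] at h
    rw [map_mul, map_mul]
    exact h
  have h2 := congrArg (Polynomial.rootMultiplicity a) h1
  rw [Polynomial.rootMultiplicity_mul (mul_ne_zero hn hQ),
    Polynomial.rootMultiplicity_mul (mul_ne_zero hP hd)] at h2
  unfold ordAt
  omega

theorem ordAt_algebraMap (a : k) {P : k[X]} (hP : P ≠ 0) :
    ordAt a (algebraMap k[X] (RatFunc k) P) = P.rootMultiplicity a := by
  have h := ordAt_div a hP (one_ne_zero : (1 : k[X]) ≠ 0)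
  rw [map_one, div_one] at h
  rw [h, ← Polynomial.C_1, Polynomial.rootMultiplicity_C]
  simp

theorem ordAt_mul (a : k) {f g : RatFunc k} (hf : f ≠ 0) (hg : g ≠ 0) :
    ordAt a (f * g) = ordAt a f + ordAt a g := by
  have hfn := RatFunc.num_ne_zero hf
  have hgn := RatFunc.num_ne_zero hg
  have h : f * g = algebraMap k[X] (RatFunc k) (f.num * g.num) /
      algebraMap k[X] (RatFunc k) (f.denom * g.denom) := by
    rw [map_mul, map_mul, mul_div_mul_comm, f.num_div_denom, g.num_div_denom]
  rw [h, ordAt_div a (mul_ne_zero hfn hgn) (mul_ne_zero f.denom_ne_zero g.denom_ne_zero),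
    Polynomial.rootMultiplicity_mul (mul_ne_zero hfn hgn),
    Polynomial.rootMultiplicity_mul (mul_ne_zero f.denom_ne_zero g.denom_ne_zero)]
  unfold ordAt
  push_cast
  ring

@[simp]
theorem ordAt_one (a : k) : ordAt a (1 : RatFunc k) = 0 := by
  have h := ordAt_mul a (one_ne_zero : (1 : RatFunc k) ≠ 0) one_ne_zero
  rw [mul_one] at h
  omega

theorem ordAt_inv (a : k) (f : RatFunc k) : ordAt a f⁻¹ = -ordAt a f := by
  rcases eq_or_ne f 0 with rfl | hf
  · rw [inv_zero]
    simp [ordAt, ← Polynomial.C_1, -map_one, Polynomial.rootMultiplicity_C]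
  have h := ordAt_mul a hf (inv_ne_zero hf)
  rw [mul_inv_cancel₀ hf, ordAt_one] at h
  omega

theorem ordAt_pow (a : k) {f : RatFunc k} (hf : f ≠ 0) (n : ℕ) :
    ordAt a (f ^ n) = n * ordAt a f := by
  induction n with
  | zero => simp
  | succ n ih =>
    rw [pow_succ, ordAt_mul a (pow_ne_zero n hf) hf, ih]
    push_cast
    ring

theorem ordAt_zpow (a : k) {f : RatFunc k} (hf : f ≠ 0) (n : ℤ) :
    ordAt a (f ^ n) = n * ordAt a f := by
  obtain ⟨m, rfl | rfl⟩ := n.eq_nat_or_neg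
  · rw [zpow_natCast, ordAt_pow a hf]
  · rw [zpow_neg, zpow_natCast, ordAt_inv, ordAt_pow a hf]
    ring

theorem ordAt_prod (a : k) {ι : Type*} (s : Finset ι) (f : ι → RatFunc k)
    (hf : ∀ i ∈ s, f i ≠ 0) : ordAt a (∏ i ∈ s, f i) = ∑ i ∈ s, ordAt a (f i) := by
  classical
  induction s using Finset.induction_on with
  | empty => simp
  | insert i s hi ih =>
    have h : ∀ j ∈ s, f j ≠ 0 := fun j hj => hf j (Finset.mem_insert_of_mem hj)
    rw [Finset.prod_insert hi, Finset.sum_insert hi,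
      ordAt_mul a (hf i (Finset.mem_insert_self i s)) (Finset.prod_ne_zero_iff.2 h), ih h]

theorem X_sub_C_ne_zero (b : k) : (RatFunc.X - RatFunc.C b : RatFunc k) ≠ 0 := by
  rw [← RatFunc.algebraMap_X, ← RatFunc.algebraMap_C, ← map_sub]
  exact RatFunc.algebraMap_ne_zero (Polynomial.X_sub_C_ne_zero b)

theorem ordAt_X_sub_C_self (a : k) : ordAt a (RatFunc.X - RatFunc.C a : RatFunc k) = 1 := by
  rw [← RatFunc.algebraMap_X, ← RatFunc.algebraMap_C, ← map_sub,
    ordAt_algebraMap a (Polynomial.X_sub_C_ne_zero a), Polynomial.rootMultiplicity_X_sub_C_self]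
  rfl

theorem ordAt_X_sub_C_of_ne {a b : k} (h : a ≠ b) :
    ordAt a (RatFunc.X - RatFunc.C b : RatFunc k) = 0 := by
  classical
  rw [← RatFunc.algebraMap_X, ← RatFunc.algebraMap_C, ← map_sub,
    ordAt_algebraMap a (Polynomial.X_sub_C_ne_zero b), Polynomial.rootMultiplicity_X_sub_C,
    if_neg h]
  rfl

theorem mem_localRing_some {a : k} {f : RatFunc k} :
    f ∈ localRing (OnePoint.some a) ↔ f.denom.eval a ≠ 0 := Iff.rfl

theorem ordAt_nonneg_iff {a : k} {f : RatFunc k} (hf : f ≠ 0) :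
    0 ≤ ordAt a f ↔ f ∈ localRing (OnePoint.some a) := by
  rw [mem_localRing_some]
  unfold ordAt
  constructor
  · intro h hd
    have hd1 : 0 < f.denom.rootMultiplicity a :=
      (Polynomial.rootMultiplicity_pos f.denom_ne_zero).2 hd
    have hn1 : 0 < f.num.rootMultiplicity a := by omega
    have hn := (Polynomial.rootMultiplicity_pos (RatFunc.num_ne_zero hf)).1 hn1
    obtain ⟨c, d, hcd⟩ := f.isCoprime_num_denom
    have := congrArg (Polynomial.eval a) hcd
    rw [eval_add, eval_mul, eval_mul, hn.eq_zero, hd] at this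
    simp at this
  · intro h
    rw [Polynomial.rootMultiplicity_eq_zero h]
    simp

theorem mem_localRing_inv {a : k} {f : RatFunc k} (hf : f ≠ 0) (h : ordAt a f = 0) :
    f⁻¹ ∈ localRing (OnePoint.some a) := by
  rw [← ordAt_nonneg_iff (inv_ne_zero hf), ordAt_inv, h]
  simp

theorem algebraMap_mem_localRing (a : k) (P : k[X]) :
    algebraMap k[X] (RatFunc k) P ∈ localRing (OnePoint.some a) := by
  rcases eq_or_ne P 0 with rfl | hP
  · rw [map_zero]
    exact Subring.zero_mem _
  · rw [← ordAt_nonneg_iff (RatFunc.algebraMap_ne_zero hP), ordAt_algebraMap a hP]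
    omega

theorem localParam_mem_localRing (a : k) :
    localParam (OnePoint.some a) ∈ localRing (OnePoint.some a) := by
  change RatFunc.X - RatFunc.C a ∈ _
  rw [← RatFunc.algebraMap_X, ← RatFunc.algebraMap_C, ← map_sub]
  exact algebraMap_mem_localRing a _

/-- A rational function that is regular at all finite points is a polynomial. -/
theorem exists_polynomial_of_mem_localRing [IsAlgClosed k] {f : RatFunc k}
    (h : ∀ a : k, f ∈ localRing (OnePoint.some a)) :
    ∃ P : k[X], f = algebraMap k[X] (RatFunc k) P := by
  have hdeg : f.denom.degree = 0 := by
    by_contra hne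
    obtain ⟨a, ha⟩ := IsAlgClosed.exists_root f.denom hne
    exact h a ha
  have h1 : f.denom = 1 := by
    exact Polynomial.Monic.eq_one_of_isUnit f.monic_denom
      (Polynomial.isUnit_iff_degree_eq_zero.2 hdeg)
  refine ⟨f.num, ?_⟩
  conv_lhs => rw [← f.num_div_denom, h1, map_one, div_one]

/-- A rational function without finite zeros and poles is a constant. -/
theorem exists_const_of_ordAt_eq_zero [IsAlgClosed k] {f : RatFunc k} (hf : f ≠ 0)
    (h : ∀ a : k, ordAt a f = 0) : ∃ c : k, c ≠ 0 ∧ f = RatFunc.C c := by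
  obtain ⟨P, rfl⟩ := exists_polynomial_of_mem_localRing
    (fun a => (ordAt_nonneg_iff hf).1 (h a).ge)
  have hP : P ≠ 0 := by
    rintro rfl
    simp at hf
  have hdeg : P.degree = 0 := by
    by_contra hne
    obtain ⟨a, ha⟩ := IsAlgClosed.exists_root P hne
    have h1 := (Polynomial.rootMultiplicity_pos hP).2 ha
    have h2 := h a
    rw [ordAt_algebraMap a hP] at h2
    omega
  rw [Polynomial.eq_C_of_degree_eq_zero hdeg] at hf ⊢
  refine ⟨P.coeff 0, ?_, RatFunc.algebraMap_C _⟩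
  intro h0
  rw [h0] at hf
  simp at hf

theorem ddt_algebraMap (P : k[X]) :
    ddt (algebraMap k[X] (RatFunc k) P) = algebraMap k[X] (RatFunc k) (derivative P) := by
  have h := ddtFun_div P 1 one_ne_zero
  rw [map_one, div_one] at h
  change ddtFun _ = _
  rw [h]
  simp

theorem ddt_X_sub_C (b : k) : ddt (RatFunc.X - RatFunc.C b : RatFunc k) = 1 := by
  rw [← RatFunc.algebraMap_X, ← RatFunc.algebraMap_C, ← map_sub, ddt_algebraMap]
  simp

theorem ddt_mem_localRing {a : k} {f : RatFunc k} (hf : f ∈ localRing (OnePoint.some a)) :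
    ddt f ∈ localRing (OnePoint.some a) := by
  have hd : algebraMap k[X] (RatFunc k) f.denom ≠ 0 :=
    RatFunc.algebraMap_ne_zero f.denom_ne_zero
  have h0 : ordAt a (algebraMap k[X] (RatFunc k) f.denom) = 0 := by
    rw [ordAt_algebraMap a f.denom_ne_zero, Polynomial.rootMultiplicity_eq_zero hf]
    rfl
  change ddtFun f ∈ _
  unfold ddtFun
  rw [div_eq_mul_inv, ← inv_pow]
  exact Subring.mul_mem _ (algebraMap_mem_localRing a _)
    (Subring.pow_mem _ (mem_localRing_inv hd h0) 2)

theorem ddt_zpow {f : RatFunc k} (hf : f ≠ 0) (n : ℤ) :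
    ddt (f ^ n) = n * f ^ (n - 1) * ddt f := by
  obtain ⟨m, rfl | rfl⟩ := n.eq_nat_or_neg
  · rcases m with _ | m
    · simp
    · rw [zpow_natCast, Derivation.leibniz_pow]
      have : ((m + 1 : ℕ) : ℤ) - 1 = (m : ℕ) := by push_cast; ring
      rw [this, zpow_natCast]
      simp [mul_assoc]
  · rcases m with _ | m
    · simp
    · have h1 : f ^ (-((m + 1 : ℕ) : ℤ)) * f ^ (m + 1) = 1 := by
        rw [zpow_neg, zpow_natCast, inv_mul_cancel₀ (pow_ne_zero _ hf)]
      have h2 := congrArg ddt h1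
      rw [Derivation.leibniz, Derivation.leibniz_pow, Derivation.map_one_eq_zero] at h2
      have h3 : f ^ (-((m + 1 : ℕ) : ℤ) - 1) * f = f ^ (-((m + 1 : ℕ) : ℤ)) := by
        rw [← zpow_add_one₀ hf]
        congr 1
      simp only [smul_eq_mul, nsmul_eq_mul, add_tsub_cancel_right] at h2
      have hp : f ^ (m + 1) ≠ 0 := pow_ne_zero _ hf
      apply mul_left_cancel₀ hp
      rw [← h3] at h2 ⊢
      push_cast at h2 ⊢
      rw [pow_succ] at h2 ⊢
      linear_combination h2

/-- In characteristic `p` the orders of a rational function with vanishing derivative are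
divisible by `p`. -/
theorem ordAt_cast_eq_zero_of_ddt_eq_zero (a : k) {f : RatFunc k} (hf : f ≠ 0) (h : ddt f = 0) :
    ((ordAt a f : ℤ) : k) = 0 := by
  by_contra hm
  set m := ordAt a f with hmdef
  set s : RatFunc k := RatFunc.X - RatFunc.C a with hs
  have hs0 : s ≠ 0 := X_sub_C_ne_zero a
  set g := s ^ (-m) * f with hg
  have hg0 : g ≠ 0 := mul_ne_zero (zpow_ne_zero _ hs0) hf
  have hgo : ordAt a g = 0 := by
    rw [hg, ordAt_mul a (zpow_ne_zero _ hs0) hf, ordAt_zpow a hs0, ordAt_X_sub_C_self, ← hmdef]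
    ring
  have hdg : s * ddt g = -(m : RatFunc k) * g := by
    rw [hg, Derivation.leibniz, h, ddt_zpow hs0, ddt_X_sub_C]
    have : s ^ (-m - 1) * s = s ^ (-m) := by
      rw [← zpow_add_one₀ hs0]
      congr 1
      ring
    simp only [smul_eq_mul]
    push_cast
    linear_combination (-(m : RatFunc k) * f) * this
  have hmC : (m : RatFunc k) = RatFunc.C (m : k) := (map_intCast (RatFunc.C (K := k)) m).symm
  have hmne : -(m : RatFunc k) ≠ 0 := by
    rw [neg_ne_zero, hmC, Ne, map_eq_zero]
    exact hm
  have hmo : ordAt a (-(m : RatFunc k)) = 0 := by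
    rw [hmC, ← map_neg, ← RatFunc.algebraMap_C, ordAt_algebraMap, Polynomial.rootMultiplicity_C]
    · rfl
    · rw [Ne, Polynomial.C_eq_zero, neg_eq_zero]
      exact hm
  have hdg0 : ddt g ≠ 0 := by
    intro h0
    rw [h0, mul_zero] at hdg
    exact mul_ne_zero hmne hg0 hdg.symm
  have h1 := congrArg (ordAt a) hdg
  rw [ordAt_mul a hs0 hdg0, ordAt_mul a hmne hg0, hmo, hgo, ordAt_X_sub_C_self] at h1
  have h2 := (ordAt_nonneg_iff hdg0).2 (ddt_mem_localRing ((ordAt_nonneg_iff hg0).1 hgo.ge))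
  omega

/-- `t - a` is not a unit of the local ring at `a`. -/
theorem not_mul_eq_one_of_mem_localRing {a : k} {f : RatFunc k}
    (hf : f ∈ localRing (OnePoint.some a)) : (RatFunc.X - RatFunc.C a) * f ≠ 1 := by
  intro h
  have hf0 : f ≠ 0 := by
    rintro rfl
    simp at h
  have h1 := congrArg (ordAt a) h
  rw [ordAt_mul a (X_sub_C_ne_zero a) hf0, ordAt_X_sub_C_self, ordAt_one] at h1
  have := (ordAt_nonneg_iff hf0).2 hf
  omega

theorem exists_eq_pow_mul {a : k} {f : RatFunc k} (hf : f ≠ 0) {n : ℕ} (h : (n : ℤ) ≤ ordAt a f) :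
    ∃ g ∈ localRing (OnePoint.some a), f = (RatFunc.X - RatFunc.C a) ^ n * g := by
  have hs := X_sub_C_ne_zero a
  have hs' := inv_ne_zero (pow_ne_zero n hs)
  refine ⟨((RatFunc.X - RatFunc.C a) ^ n)⁻¹ * f, ?_, ?_⟩
  · rw [← ordAt_nonneg_iff (mul_ne_zero hs' hf), ordAt_mul a hs' hf, ordAt_inv, ordAt_pow a hs,
      ordAt_X_sub_C_self]
    omega
  · rw [mul_inv_cancel_left₀ (pow_ne_zero n hs)]

theorem ordAt_const {c : k} (hc : c ≠ 0) (a : k) : ordAt a (RatFunc.C c) = 0 := by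
  rw [← RatFunc.algebraMap_C, ordAt_algebraMap a (Polynomial.C_ne_zero.2 hc),
    Polynomial.rootMultiplicity_C]
  rfl

theorem ordAt_neg_one (a : k) : ordAt a (-1 : RatFunc k) = 0 := by
  rw [← map_one (RatFunc.C (K := k)), ← map_neg]
  exact ordAt_const (neg_ne_zero.2 one_ne_zero) a

theorem iterate_ddt_mul {g : RatFunc k} (hg : ddt g = 0) (n : ℕ) (f : RatFunc k) :
    (ddt : Derivation k (RatFunc k) (RatFunc k))^[n] (g * f) =
      g * (ddt : Derivation k (RatFunc k) (RatFunc k))^[n] f := by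
  induction n with
  | zero => rfl
  | succ n ih =>
    rw [Function.iterate_succ_apply', ih, Function.iterate_succ_apply', Derivation.leibniz, hg,
      smul_zero, add_zero, smul_eq_mul]

end Orders

/-! ### Iterated connections and Jacobson's formula -/

section Jacobson

/-- The Leibniz rule for the iterates of a connection. -/
theorem iterate_leibniz {R : Type*} {W : Type*} [CommRing R] [AddCommGroup W] [Module R W]
    (δ : R → R) (N : W →+ W) (h : ∀ (f : R) (e : W), N (f • e) = δ f • e + f • N e)
    (n : ℕ) (f : R) (e : W) :
    N^[n] (f • e) = ∑ ij ∈ Finset.HasAntidiagonal.antidiagonal n,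
      n.choose ij.1 • (δ^[ij.1] f • N^[ij.2] e) := by
  induction n with
  | zero => simp
  | succ n ih =>
    rw [Function.iterate_succ_apply', ih, map_sum,
      Finset.sum_antidiagonal_choose_succ_nsmul (fun i j => δ^[i] f • N^[j] e) n,
      ← Finset.sum_add_distrib]
    refine Finset.sum_congr rfl fun ij hij => ?_
    have hs : n.choose ij.2 = n.choose ij.1 := by
      rw [Finset.HasAntidiagonal.mem_antidiagonal] at hij
      rw [← hij, Nat.choose_symm_add]
    rw [map_nsmul, h, hs, ← Function.iterate_succ_apply' δ, ← Function.iterate_succ_apply' N,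
      smul_add, add_comm]

/-- In characteristic `p` the `p`-th iterate of a connection again satisfies the Leibniz rule. -/
theorem iterate_char_leibniz {R : Type*} {W : Type*} [CommRing R] [AddCommGroup W] [Module R W]
    (p : ℕ) [hp : Fact p.Prime] [CharP R p]
    (δ : R → R) (N : W →+ W) (h : ∀ (f : R) (e : W), N (f • e) = δ f • e + f • N e)
    (f : R) (e : W) : N^[p] (f • e) = δ^[p] f • e + f • N^[p] e := by
  have hp0 : p ≠ 0 := hp.out.ne_zero
  rw [iterate_leibniz δ N h, ← Finset.sum_subset
    (s₁ := {(p, 0), (0, p)}) (by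
      intro ij hij
      simp only [Finset.mem_insert, Finset.mem_singleton] at hij
      rcases hij with rfl | rfl <;> simp)]
  · rw [Finset.sum_pair (by simp [hp0])]
    simp
  · rintro ⟨i, j⟩ hij hne
    rw [Finset.HasAntidiagonal.mem_antidiagonal] at hij
    simp only [Finset.mem_insert, Finset.mem_singleton, Prod.mk.injEq, not_or] at hij hne
    have hd : p ∣ p.choose i := hp.out.dvd_choose_self (by omega) (by omega)
    rw [← Nat.cast_smul_eq_nsmul R, (CharP.cast_eq_zero_iff R p _).2 hd, zero_smul]

/-- For commuting additive maps, the commutator of `∂` with the powers of the twist `D + H` is a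
combination of the derivatives of `∂ H`, with binomial coefficients (here the powers are evaluated
at `1`). -/
theorem commutator_twist_iterate {k A : Type*} [CommRing k] [CommRing A] [Algebra k A]
    (D d : Derivation k A A)
    (hcomm : ∀ f, d (D f) = D (d f)) (H : A) (N : A → A) (hN : ∀ f, N f = D f + H * f) (n : ℕ) :
    d (N^[n] 1) =
      ∑ i ∈ Finset.range n, n.choose (i + 1) • (D^[i] (d H) * N^[n - 1 - i] 1) := by
  have hdN : ∀ f, d (N f) = N (d f) + d H * f := by
    intro f
    rw [hN, hN, map_add, hcomm, Derivation.leibniz, smul_eq_mul, smul_eq_mul]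
    ring
  have hNmul : ∀ f g, N (f * g) = D f * g + f * N g := by
    intro f g
    rw [hN, hN, Derivation.leibniz, smul_eq_mul, smul_eq_mul]
    ring
  have hNsum : ∀ (s : Finset ℕ) (c : ℕ → ℕ) (f : ℕ → A),
      N (∑ i ∈ s, c i • f i) = ∑ i ∈ s, c i • N (f i) := by
    intro s c f
    simp only [hN, map_sum, map_nsmul, Finset.mul_sum, ← Finset.sum_add_distrib, smul_add,
      mul_smul_comm]
  induction n with
  | zero => simp
  | succ n ih =>
    rw [Function.iterate_succ_apply', hdN, ih, hNsum]
    have e1 : ∀ i ∈ Finset.range n,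
        n.choose (i + 1) • N (D^[i] (d H) * N^[n - 1 - i] 1) =
          n.choose (i + 1) • (D^[i + 1] (d H) * N^[n - (i + 1)] 1) +
          n.choose (i + 1) • (D^[i] (d H) * N^[n - i] 1) := by
      intro i hi
      rw [Finset.mem_range] at hi
      rw [hNmul, ← Function.iterate_succ_apply' D, ← Function.iterate_succ_apply' N, smul_add,
        show n - 1 - i = n - (i + 1) by omega, show (n - (i + 1)).succ = n - i by omega]
    rw [Finset.sum_congr rfl e1, Finset.sum_add_distrib]
    have e2 : ∑ i ∈ Finset.range (n + 1),
        (n + 1).choose (i + 1) • (D^[i] (d H) * N^[n + 1 - 1 - i] 1) =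
        ∑ i ∈ Finset.range (n + 1), n.choose i • (D^[i] (d H) * N^[n - i] 1) +
        ∑ i ∈ Finset.range (n + 1), n.choose (i + 1) • (D^[i] (d H) * N^[n - i] 1) := by
      rw [← Finset.sum_add_distrib]
      refine Finset.sum_congr rfl fun i _ => ?_
      rw [Nat.choose_succ_succ, add_smul, Nat.add_sub_cancel]
    rw [e2, Finset.sum_range_succ' (fun i => n.choose i • (D^[i] (d H) * N^[n - i] 1)) n,
      Finset.sum_range_succ (fun i => n.choose (i + 1) • (D^[i] (d H) * N^[n - i] 1)) n]
    simp only [Nat.choose_zero_right, one_smul, Function.iterate_zero, id_eq, Nat.sub_zero,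
      Nat.choose_succ_self, zero_smul, add_zero]
    abel

/-- Jacobson's formula: over a field of characteristic `p`, the `p`-th power of the differential
operator `D + h`, evaluated at `1`, is `D^{p-1} h + h^p`. The proof replaces `h` by `h X`. The
commutator formula for the formal derivative shows that `(D + h X)^p 1` is a polynomial in `X` of
degree at most `p` with derivative `D^{p-1} h`. -/
theorem jacobson_formula {F : Type*} [Field F] (p : ℕ) [hp : Fact p.Prime] [CharP F p]
    (D : Derivation ℤ F F) (h : F) (N : F → F) (hN : ∀ f, N f = D f + h * f) :
    N^[p] 1 = D^[p - 1] h + h ^ p := by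
  have hp0 : 0 < p := hp.out.pos
  have hp2 : 2 ≤ p := hp.out.two_le
  let : Differential F := ⟨D⟩
  let DX : Derivation ℤ F[X] F[X] := Differential.mapCoeffs
  let d : Derivation ℤ F[X] F[X] := Polynomial.derivative'.restrictScalars ℤ
  have hd : ∀ f, d f = derivative f := fun _ => rfl
  have hcoeff : ∀ (f : F[X]) (i : ℕ), (DX f).coeff i = D (f.coeff i) := fun _ _ => rfl
  let M : F[X] → F[X] := fun f => DX f + (C h * X) * f
  have hM0 : ∀ f, (M f).coeff 0 = D (f.coeff 0) := by
    intro f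
    simp [M, hcoeff, mul_assoc]
  have hM1 : ∀ f i, (M f).coeff (i + 1) = D (f.coeff (i + 1)) + h * f.coeff i := by
    intro f i
    simp [M, hcoeff, mul_assoc, Polynomial.coeff_X_mul]
  have hcomm : ∀ f, d (DX f) = DX (d f) := by
    intro f
    ext i
    rw [hd, hd, hcoeff, Polynomial.coeff_derivative, Polynomial.coeff_derivative, hcoeff,
      Derivation.leibniz]
    have h0 : D ((i : F) + 1) = 0 := by
      rw [map_add, Derivation.map_natCast, Derivation.map_one_eq_zero, add_zero]
    rw [h0, smul_zero, zero_add, smul_eq_mul, mul_comm]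
  have hdH : d (C h * X) = C h := by
    rw [hd]
    simp
  have hiterC : ∀ n, DX^[n] (C h) = C (D^[n] h) := by
    intro n
    induction n with
    | zero => rfl
    | succ n ih =>
      rw [Function.iterate_succ_apply', Function.iterate_succ_apply', ih]
      exact Differential.mapCoeffs_C _
  have hder : derivative (M^[p] 1) = C (D^[p - 1] h) := by
    refine (commutator_twist_iterate DX d hcomm (C h * X) M (fun _ => rfl) p).trans ?_
    rw [Finset.sum_eq_single (p - 1)]
    · rw [Nat.sub_add_cancel hp0, Nat.choose_self, one_smul, Nat.sub_self, hdH, hiterC]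
      simp
    · intro i hi hne
      rw [Finset.mem_range] at hi
      have hdvd : p ∣ p.choose (i + 1) := hp.out.dvd_choose_self (by omega) (by omega)
      rw [← Nat.cast_smul_eq_nsmul F, (CharP.cast_eq_zero_iff F p _).2 hdvd, zero_smul]
    · intro hni
      exact absurd (Finset.mem_range.2 (by omega)) hni
  -- the degree in `X` is at most `n`, with top coefficient `h ^ n`
  have htop : ∀ n, (∀ i, n < i → (M^[n] 1).coeff i = 0) ∧ (M^[n] 1).coeff n = h ^ n := by
    intro n
    induction n with
    | zero =>
      refine ⟨fun i hi => ?_, ?_⟩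
      · rw [Function.iterate_zero, id_eq, Polynomial.coeff_one, if_neg (by omega)]
      · simp
    | succ n ih =>
      rw [Function.iterate_succ_apply']
      refine ⟨fun i hi => ?_, ?_⟩
      · obtain ⟨j, rfl⟩ : ∃ j, i = j + 1 := ⟨i - 1, by omega⟩
        rw [hM1, ih.1 (j + 1) (by omega), ih.1 j (by omega)]
        simp
      · rw [hM1, ih.1 (n + 1) (by omega), ih.2, map_zero, zero_add, pow_succ, mul_comm]
  have hbot : (M^[p] 1).coeff 0 = 0 := by
    have : ∀ n, (M^[n + 1] 1).coeff 0 = 0 := by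
      intro n
      induction n with
      | zero => simp [hM0]
      | succ n ih => rw [Function.iterate_succ_apply', hM0, ih, map_zero]
    obtain ⟨m, rfl⟩ : ∃ m, p = m + 1 := ⟨p - 1, by omega⟩
    exact this m
  have hmid : ∀ i, (M^[p] 1).coeff (i + 1) * ((i : F) + 1) =
      if i = 0 then D^[p - 1] h else 0 := by
    intro i
    rw [← Polynomial.coeff_derivative, hder, Polynomial.coeff_C]
  -- for `0 < i + 1 < p` the factor `i + 1` in the derivative is invertible
  have hsupp : M^[p] 1 = C (D^[p - 1] h) * X + C (h ^ p) * X ^ p := by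
    ext i
    rw [Polynomial.coeff_add, Polynomial.coeff_C_mul_X, Polynomial.coeff_C_mul_X_pow]
    rcases lt_trichotomy i p with hi | rfl | hi
    · rcases i with _ | i
      · rw [hbot, if_neg (by omega), if_neg (by omega), add_zero]
      · have hi0 : ((i : F) + 1) ≠ 0 := by
          intro h0
          have : ((i + 1 : ℕ) : F) = 0 := by exact_mod_cast h0
          rw [CharP.cast_eq_zero_iff F p] at this
          exact absurd (Nat.le_of_dvd (by omega) this) (by omega)
        apply mul_right_cancel₀ hi0
        rw [hmid, if_neg (by omega : ¬ i + 1 = p), add_zero]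
        rcases i with _ | i
        · simp
        · simp
    · rw [(htop i).2, if_neg (by omega), if_pos rfl, zero_add]
    · rw [(htop p).1 i hi, if_neg (by omega), if_neg (by omega), add_zero]
  have heval : ∀ f : F[X], (M f).eval 1 = N (f.eval 1) := by
    intro f
    have h1 : (DX f).eval 1 = D (f.eval 1) := by
      have h2 : ∀ g : F[X], g.eval 1 = g.sum fun _ a => a := by
        intro g
        rw [Polynomial.eval_eq_sum]
        simp
      rw [h2 f, Polynomial.sum, map_sum, Polynomial.eval_eq_sum,
        Polynomial.sum_eq_of_subset _ (s := f.support) (by simp) (by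
          intro i hi
          rw [Polynomial.mem_support_iff] at hi ⊢
          intro h0
          rw [hcoeff, h0, map_zero] at hi
          exact hi rfl)]
      simp [hcoeff]
    simp only [M, eval_add, eval_mul, eval_C, eval_X, h1, hN, mul_one]
  have hiter : ∀ n, (M^[n] 1).eval 1 = N^[n] 1 := by
    intro n
    induction n with
    | zero => simp
    | succ n ih => rw [Function.iterate_succ_apply', Function.iterate_succ_apply', heval, ih]
  rw [← hiter, hsupp]
  simp

/-- If `D^p = 0` and `D^{p-1} h = -h^p`, then `h` is a logarithmic derivative: the operator `D - h`
is nilpotent, so it has a nonzero kernel. -/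
theorem exists_eq_mul_of_iterate_eq_neg_pow {F : Type*} [Field F] (p : ℕ) [hp : Fact p.Prime]
    [CharP F p] (D : Derivation ℤ F F) (hD : ∀ f, D^[p] f = 0) (h : F)
    (hh : D^[p - 1] h = -h ^ p) : ∃ y : F, y ≠ 0 ∧ D y = h * y := by
  by_contra! hne
  let N : F →+ F := (D : F →+ F) + AddMonoidHom.mulLeft (-h)
  have hN : ∀ f, N f = D f + (-h) * f := fun _ => rfl
  have hneg : D^[p - 1] (-h) = -D^[p - 1] h := by
    have : ∀ n, D^[n] (-h) = -D^[n] h := by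
      intro n
      induction n with
      | zero => rfl
      | succ n ih => rw [Function.iterate_succ_apply', Function.iterate_succ_apply', ih, map_neg]
    exact this _
  have h1 : N^[p] 1 = 0 := by
    rw [jacobson_formula p D (-h) N hN, hneg, hh, neg_neg]
    rcases hp.out.eq_two_or_odd' with rfl | hodd
    · have : (2 : F) = 0 := CharP.cast_eq_zero F 2
      linear_combination (h ^ 2) * this
    · rw [hodd.neg_pow, add_neg_cancel]
  have h2 : ∀ n, N^[n] 1 ≠ 0 := by
    intro n
    induction n with
    | zero => exact one_ne_zero
    | succ n ih =>
      rw [Function.iterate_succ_apply', hN]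
      intro h0
      exact hne _ ih (by linear_combination h0)
  exact h2 p h1

end Jacobson

/-! ### Extension of the derivation to separable extensions -/

section Extension

variable {k : Type u} [Field k]

/-- Every derivation of `k(t)` over `k` is determined by its value at `t`. -/
theorem derivation_eq_ddt_smul {W : Type*} [AddCommGroup W] [Module k W] [Module (RatFunc k) W]
    [IsScalarTower k (RatFunc k) W] (δ : Derivation k (RatFunc k) W) (f : RatFunc k) :
    δ f = ddt f • δ RatFunc.X := by
  let : Module k[X] W := Module.compHom W (algebraMap k[X] (RatFunc k))
  have : IsScalarTower k[X] (RatFunc k) W := ⟨fun a b c => by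
    rw [Algebra.smul_def, mul_smul]
    rfl⟩
  have : IsScalarTower k k[X] W := ⟨fun a b c => by
    change algebraMap k[X] (RatFunc k) (a • b) • c = a • (algebraMap k[X] (RatFunc k) b • c)
    rw [Algebra.smul_def, map_mul, mul_smul, ← IsScalarTower.algebraMap_apply, algebraMap_smul]⟩
  set δ' : Derivation k (RatFunc k) W :=
    δ - (LinearMap.toSpanSingleton (RatFunc k) W (δ RatFunc.X)).compDer ddt with hδ'
  have hval : ∀ g, δ' g = δ g - ddt g • δ RatFunc.X := fun _ => rfl
  have hX : δ' RatFunc.X = 0 := by rw [hval, ddt_X, one_smul, sub_self]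
  have hpoly : ∀ P : k[X], δ' (algebraMap k[X] (RatFunc k) P) = 0 := by
    have h0 : δ'.compAlgebraMap k[X] = 0 := by
      apply Polynomial.derivation_ext
      change δ' (algebraMap k[X] (RatFunc k) Polynomial.X) = 0
      rw [RatFunc.algebraMap_X, hX]
    intro P
    exact congrArg (fun d : Derivation k k[X] W => d P) h0
  have hd : algebraMap k[X] (RatFunc k) f.denom ≠ 0 :=
    RatFunc.algebraMap_ne_zero f.denom_ne_zero
  have h1 : algebraMap k[X] (RatFunc k) f.denom * f = algebraMap k[X] (RatFunc k) f.num := by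
    rw [mul_comm]
    exact ((div_eq_iff hd).1 f.num_div_denom).symm
  have h2 := congrArg δ' h1
  rw [Derivation.leibniz, hpoly, hpoly, smul_zero, add_zero] at h2
  have h3 := (smul_eq_zero.1 h2).resolve_left hd
  rw [hval] at h3
  exact sub_eq_zero.1 h3

variable {F : Type w} [Field F] [Algebra k F] [Algebra (RatFunc k) F]

/-- On a separable extension of `k(t)` the form `dt` generates the differentials, and the derivation
dual to it extends `d/dt`. -/
theorem exists_derivation_extension [IsScalarTower k (RatFunc k) F]
    [Algebra.IsSeparable (RatFunc k) F] :
    dt k F ≠ 0 ∧ ∃ D : Derivation k F F,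
      (∀ f, D (algebraMap (RatFunc k) F f) = algebraMap (RatFunc k) F (ddt f)) ∧
      ∀ y, KaehlerDifferential.D k F y = D y • dt k F := by
  have : Algebra.FormallyEtale (RatFunc k) F := Algebra.FormallyEtale.of_isSeparable _ _
  let e := KaehlerDifferential.tensorKaehlerEquivOfFormallyEtale k (RatFunc k) F
  let φ : F ⊗[RatFunc k] Ω[RatFunc k⁄k] →ₗ[F] F := LinearMap.liftBaseChange F
    ((Algebra.linearMap (RatFunc k) F).comp
      (ddt : Derivation k (RatFunc k) (RatFunc k)).liftKaehlerDifferential)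
  let ψ : Ω[F⁄k] →ₗ[F] F := φ.comp e.symm.toLinearMap
  have hψ : ∀ f : RatFunc k, ψ (KaehlerDifferential.D k F (algebraMap (RatFunc k) F f)) =
      algebraMap (RatFunc k) F (ddt f) := by
    intro f
    change φ (e.symm _) = _
    rw [KaehlerDifferential.tensorKaehlerEquivOfFormallyEtale_symm_D_algebraMap]
    simp [φ]
  have hdt : ψ (dt k F) = 1 := by
    unfold dt
    rw [hψ, ddt_X, map_one]
  have hspan : ∀ τ, e τ = φ τ • dt k F := by
    have : e.toLinearMap = φ.smulRight (dt k F) := by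
      apply TensorProduct.AlgebraTensorModule.curry_injective
      ext x
      have hx := derivation_eq_ddt_smul (KaehlerDifferential.D k (RatFunc k)) x
      have h1 : e (1 ⊗ₜ KaehlerDifferential.D k (RatFunc k) RatFunc.X) = dt k F := by
        rw [← KaehlerDifferential.tensorKaehlerEquivOfFormallyEtale_symm_D_algebraMap,
          LinearEquiv.apply_symm_apply]
        rfl
      have h2 : e (1 ⊗ₜ KaehlerDifferential.D k (RatFunc k) x) = ddt x • dt k F := by
        rw [hx, TensorProduct.tmul_smul, ← algebraMap_smul F (ddt x), map_smul, h1, algebraMap_smul]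
      simpa [φ] using h2
    intro τ
    exact congrArg (fun l : F ⊗[RatFunc k] Ω[RatFunc k⁄k] →ₗ[F] Ω[F⁄k] => l τ) this
  refine ⟨fun h0 => ?_, ψ.compDer (KaehlerDifferential.D k F), hψ, fun y => ?_⟩
  · rw [h0, map_zero] at hdt
    exact zero_ne_one hdt
  · have := hspan (e.symm (KaehlerDifferential.D k F y))
    rw [LinearEquiv.apply_symm_apply] at this
    exact this

/-- In characteristic `p` the `p`-th iterate of the extension of `d/dt` is a derivation that
vanishes on `k(t)`, so it vanishes on every separable extension. -/
theorem iterate_derivation_extension_eq_zero (p : ℕ) [Fact p.Prime] [CharP k p]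
    [Algebra.IsSeparable (RatFunc k) F] (D : Derivation k F F)
    (hD : ∀ f, D (algebraMap (RatFunc k) F f) = algebraMap (RatFunc k) F (ddt f)) (y : F) :
    D^[p] y = 0 := by
  have : CharP F p := charP_of_injective_algebraMap (algebraMap k F).injective p
  have hleib : ∀ f g : F, D^[p] (f * g) = D^[p] f * g + f * D^[p] g := by
    intro f g
    refine iterate_char_leibniz (W := F) p D (D : F →+ F) (fun a b => ?_) f g
    change D (a * b) = D a * b + a * D b
    rw [Derivation.leibniz, smul_eq_mul, smul_eq_mul]
    ring
  have hbase : ∀ f, D^[p] (algebraMap (RatFunc k) F f) = 0 := by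
    have : ∀ n f, D^[n] (algebraMap (RatFunc k) F f) =
        algebraMap (RatFunc k) F ((ddt : Derivation k (RatFunc k) (RatFunc k))^[n] f) := by
      intro n
      induction n with
      | zero => intro f; rfl
      | succ n ih =>
        intro f
        rw [Function.iterate_succ_apply, Function.iterate_succ_apply, hD, ih]
    intro f
    rw [this, ddt_iterate_p, map_zero]
  have hadd : ∀ n (f g : F), D^[n] (f + g) = D^[n] f + D^[n] g := by
    intro n
    induction n with
    | zero => intro f g; rfl
    | succ n ih => intro f g; simp only [Function.iterate_succ_apply, map_add, ih]
  let Dp : Derivation (RatFunc k) F F :=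
    { toFun := D^[p]
      map_add' := hadd p
      map_smul' := fun c f => by
        rw [Algebra.smul_def, hleib, hbase, zero_mul, zero_add, RingHom.id_apply, Algebra.smul_def]
      map_one_eq_zero' := by
        have := hbase 1
        rwa [map_one] at this
      leibniz' := fun f g => by
        change D^[p] (f * g) = f * D^[p] g + g * D^[p] f
        rw [hleib]
        ring }
  have : Algebra.FormallyUnramified (RatFunc k) F := Algebra.FormallyUnramified.of_isSeparable _ _
  have hsub : KaehlerDifferential.D (RatFunc k) F y = 0 := Subsingleton.elim _ _
  change Dp y = 0
  rw [← Dp.liftKaehlerDifferential_comp_D, hsub, map_zero]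

/-- A form `ζ dt` on a separable extension of `k(t)` with `ζ^{p-1} v = 1`, where
`(d/dt)^{p-1} v = -1`, is logarithmic. -/
theorem exists_logarithmic (p : ℕ) [hp : Fact p.Prime] [CharP k p]
    [IsScalarTower k (RatFunc k) F]     [Algebra.IsSeparable (RatFunc k) F] {v : RatFunc k} {ζ : F}
    (hv : (ddt : Derivation k (RatFunc k) (RatFunc k))^[p - 1] v = -1)
    (hζ : ζ ^ (p - 1) * algebraMap (RatFunc k) F v = 1) :
    ∃ y : F, y ≠ 0 ∧ ζ • dt k F = y⁻¹ • KaehlerDifferential.D k F y := by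
  have : CharP F p := charP_of_injective_algebraMap (algebraMap k F).injective p
  obtain ⟨-, D, hD, hdy⟩ := exists_derivation_extension (k := k) (F := F)
  have hζp : ζ = ζ ^ p * algebraMap (RatFunc k) F v := by
    have h1 : ζ ^ p = ζ * ζ ^ (p - 1) := by
      rw [← pow_succ', Nat.sub_add_cancel hp.out.one_le]
    rw [h1, mul_assoc, hζ, mul_one]
  have hconst : D (ζ ^ p) = 0 := by
    rw [Derivation.leibniz_pow, ← Nat.cast_smul_eq_nsmul F, CharP.cast_eq_zero, zero_smul]
  have hiter : ∀ n f, D^[n] (ζ ^ p * algebraMap (RatFunc k) F f) = ζ ^ p *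
      algebraMap (RatFunc k) F ((ddt : Derivation k (RatFunc k) (RatFunc k))^[n] f) := by
    intro n
    induction n with
    | zero => intro f; rfl
    | succ n ih =>
      intro f
      rw [Function.iterate_succ_apply, Function.iterate_succ_apply, Derivation.leibniz, hconst,
        smul_zero, add_zero, smul_eq_mul, hD, ih]
  have hlog : D^[p - 1] ζ = -ζ ^ p := by
    conv_lhs => rw [hζp]
    rw [hiter, hv, map_neg, map_one, mul_neg, mul_one]
  obtain ⟨y, hy, hDy⟩ := exists_eq_mul_of_iterate_eq_neg_pow p (D.restrictScalars ℤ)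
    (iterate_derivation_extension_eq_zero p D hD) ζ hlog
  refine ⟨y, hy, ?_⟩
  have hDy' : D y = ζ * y := hDy
  rw [hdy, hDy', smul_smul, mul_comm ζ y, inv_mul_cancel_left₀ hy]

end Extension

/-! ### Kummer extensions of exponent `p - 1` -/

section Kummer

/-- The `(p - 1)`-st roots of unity in characteristic `p` form `𝔽_p^×`. -/
theorem exists_units_zmod_of_pow_eq_one {F : Type*} [Field F] (p : ℕ) [hp : Fact p.Prime]
    [CharP F p] {w : F} (hw : w ^ (p - 1) = 1) : ∃ c : (ZMod p)ˣ, ((c : ZMod p).cast : F) = w := by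
  classical
  have hp1 : 0 < p - 1 := by have := hp.out.two_le; omega
  let φ : ZMod p →+* F := ZMod.castHom dvd_rfl F
  let S : Finset F := Finset.univ.image fun c : (ZMod p)ˣ => φ c
  have hinj : Function.Injective fun c : (ZMod p)ˣ => φ c :=
    fun a b h => Units.ext (φ.injective h)
  have hcard : S.card = p - 1 := by
    rw [Finset.card_image_of_injective _ hinj, Finset.card_univ, ZMod.card_units]
  have hsub : S ⊆ Polynomial.nthRootsFinset (p - 1) (1 : F) := by
    intro y hy
    obtain ⟨c, -, rfl⟩ := Finset.mem_image.1 hy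
    rw [Polynomial.mem_nthRootsFinset hp1]
    have : (c : ZMod p) ^ (p - 1) = 1 := ZMod.pow_card_sub_one_eq_one c.ne_zero
    rw [← map_pow, this, map_one]
  have heq := Finset.eq_of_subset_of_card_le hsub (by
    rw [hcard, Polynomial.nthRootsFinset]
    exact (Multiset.toFinset_card_le _).trans (Polynomial.card_nthRoots _ _))
  have hmem : w ∈ S := by
    rw [heq, Polynomial.mem_nthRootsFinset hp1]
    exact hw
  obtain ⟨c, -, hc⟩ := Finset.mem_image.1 hmem
  exact ⟨c, hc⟩

variable {K F : Type*} [Field K] [Field F] [Algebra K F]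

theorem adjoin_algebraMap_mul {c : K} (hc : c ≠ 0) (z : F) :
    IntermediateField.adjoin K {algebraMap K F c * z} = IntermediateField.adjoin K {z} := by
  apply le_antisymm
  · rw [IntermediateField.adjoin_simple_le_iff]
    exact mul_mem (IntermediateField.algebraMap_mem _ c)
      (IntermediateField.mem_adjoin_simple_self K z)
  · rw [IntermediateField.adjoin_simple_le_iff]
    have h1 : z = algebraMap K F c⁻¹ * (algebraMap K F c * z) := by
      rw [← mul_assoc, ← map_mul, inv_mul_cancel₀ hc, map_one, one_mul]
    have h2 := mul_mem
      (IntermediateField.algebraMap_mem (IntermediateField.adjoin K {algebraMap K F c * z}) c⁻¹)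
      (IntermediateField.mem_adjoin_simple_self K (algebraMap K F c * z))
    rwa [← h1] at h2

/-- An element of a Galois extension with trivial stabilizer is a generator. -/
theorem adjoin_eq_top_of_stabilizer [FiniteDimensional K F] [IsGalois K F] {z : F}
    (h : ∀ s : F ≃ₐ[K] F, s z = z → s = 1) : IntermediateField.adjoin K {z} = ⊤ := by
  have h1 : (IntermediateField.adjoin K {z}).fixingSubgroup = ⊥ := by
    rw [eq_bot_iff]
    intro s hs
    exact h s ((IntermediateField.mem_fixingSubgroup_iff _ _).1 hs z
      (IntermediateField.mem_adjoin_simple_self K z))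
  rw [← IsGalois.fixedField_fixingSubgroup (IntermediateField.adjoin K {z}), h1,
    IntermediateField.fixedField_bot]

variable (p : ℕ) [hp : Fact p.Prime] [CharP K p]

theorem exists_isPrimitiveRoot_pred : ∃ ζ : K, IsPrimitiveRoot ζ (p - 1) := by
  obtain ⟨g, hg⟩ := IsCyclic.exists_generator (α := (ZMod p)ˣ)
  have h1 : orderOf g = p - 1 := by
    rw [orderOf_eq_card_of_forall_mem_zpowers hg, Nat.card_eq_fintype_card, ZMod.card_units]
  have h2 := IsPrimitiveRoot.orderOf g
  rw [h1] at h2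
  exact ⟨ZMod.castHom dvd_rfl K (g : ZMod p), (IsPrimitiveRoot.coe_units_iff.2 h2).map_of_injective
    (ZMod.castHom dvd_rfl K).injective⟩

/-- An extension generated by a root of `z ^ (p - 1) = f` is Galois. -/
theorem isGalois_of_adjoin_eq_top {f : K} (hf : f ≠ 0) {z : F}
    (hz : IntermediateField.adjoin K {z} = ⊤) (hzf : z ^ (p - 1) = algebraMap K F f) :
    FiniteDimensional K F ∧ IsGalois K F := by
  have hp1 : 0 < p - 1 := by have := hp.out.two_le; omega
  have hsep : (X ^ (p - 1) - C f).Separable := by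
    refine Polynomial.separable_X_pow_sub_C' p (p - 1) f (fun h => ?_) hf
    have := Nat.le_of_dvd hp1 h
    omega
  obtain ⟨ζ, hζ⟩ := exists_isPrimitiveRoot_pred (K := K) p
  have hsplit : (X ^ (p - 1) - C f).IsSplittingField K F := by
    rw [isSplittingField_iff_intermediateField]
    constructor
    · rw [Polynomial.map_sub, Polynomial.map_pow, Polynomial.map_X, Polynomial.map_C]
      exact X_pow_sub_C_splits_of_isPrimitiveRoot
        (hζ.map_of_injective (algebraMap K F).injective) hzf
    · rw [eq_top_iff, ← hz]
      refine IntermediateField.adjoin.mono K _ _ ?_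
      rw [Set.singleton_subset_iff, mem_rootSet_of_ne (X_pow_sub_C_ne_zero hp1 f)]
      simp [hzf]
  exact ⟨Polynomial.IsSplittingField.finiteDimensional F (X ^ (p - 1) - C f),
    IsGalois.of_separable_splitting_field hsep⟩

/-- The Kummer character of an extension generated by a root of `z ^ (p - 1) = f`. -/
theorem exists_kummer_character {f : K} (hf : f ≠ 0) {z : F}
    (hz : IntermediateField.adjoin K {z} = ⊤) (hzf : z ^ (p - 1) = algebraMap K F f) :
    ∃ χ : (F ≃ₐ[K] F) →* (ZMod p)ˣ, Function.Injective χ ∧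
      ∀ s : F ≃ₐ[K] F, s z = ((χ s : (ZMod p)ˣ) : ZMod p).cast * z := by
  have hp1 : p - 1 ≠ 0 := by have := hp.out.two_le; omega
  have : CharP F p := charP_of_injective_algebraMap (algebraMap K F).injective p
  have hz0 : z ≠ 0 := by
    rintro rfl
    rw [zero_pow hp1, eq_comm, map_eq_zero] at hzf
    exact hf hzf
  have hex : ∀ s : F ≃ₐ[K] F, ∃ c : (ZMod p)ˣ, s z = (c : ZMod p).cast * z := by
    intro s
    obtain ⟨c, hc⟩ := exists_units_zmod_of_pow_eq_one p (w := s z / z) (by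
      rw [div_pow, ← map_pow, hzf, AlgEquiv.commutes, div_self]
      rwa [Ne, map_eq_zero])
    exact ⟨c, by rw [hc, div_mul_cancel₀ _ hz0]⟩
  choose χ hχ using hex
  let φ : ZMod p →+* F := ZMod.castHom dvd_rfl F
  have huniq : ∀ c d : (ZMod p)ˣ, ((c : ZMod p).cast : F) * z = (d : ZMod p).cast * z → c = d := by
    intro c d h
    exact Units.ext (φ.injective (mul_right_cancel₀ hz0 h))
  have hfix : ∀ (s : F ≃ₐ[K] F) (c : ZMod p), s (c.cast : F) = c.cast := by
    intro s c
    rw [← ZMod.natCast_zmod_val c, ZMod.cast_natCast dvd_rfl, map_natCast]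
  refine ⟨MonoidHom.mk' χ ?_, ?_, hχ⟩
  · intro s t
    apply huniq
    rw [← hχ, AlgEquiv.mul_apply, hχ t, map_mul, hfix, hχ s, Units.val_mul,
      ZMod.cast_mul dvd_rfl]
    ring
  · intro s t hst
    have hst' : χ s = χ t := hst
    refine AlgEquiv.ext fun y => ?_
    have hy : y ∈ IntermediateField.adjoin K {z} := by rw [hz]; trivial
    induction hy using IntermediateField.adjoin_induction with
    | mem y hy =>
      rw [Set.mem_singleton_iff] at hy
      rw [hy, hχ, hχ, hst']
    | algebraMap c => rw [AlgEquiv.commutes, AlgEquiv.commutes]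
    | add a b _ _ ha hb => rw [map_add, map_add, ha, hb]
    | inv a _ ha => rw [map_inv₀, map_inv₀, ha]
    | mul a b _ _ ha hb => rw [map_mul, map_mul, ha, hb]

end Kummer

section Covers

variable {k : Type u} [Field k] {F : Type w} [Field F] [Algebra k F] [Algebra (RatFunc k) F]
  (p : ℕ) [hp : Fact p.Prime]

/-- A group that embeds into `𝔽_p^×` has order prime to `p`, so the cover is tame. -/
theorem isTame_of_injective (χ : (F ≃ₐ[RatFunc k] F) →* (ZMod p)ˣ)
    (hχ : Function.Injective χ) : IsTame k F p := by
  intro A _ _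
  have h1 : Nat.card (A.decompositionSubgroup (RatFunc k)) ∣ p - 1 := by
    refine (Subgroup.card_subgroup_dvd_card _).trans ?_
    have := Subgroup.card_dvd_of_injective χ hχ
    rwa [Nat.card_eq_fintype_card (α := (ZMod p)ˣ), ZMod.card_units] at this
  refine Nat.Coprime.of_dvd_left h1 ?_
  rw [Nat.coprime_comm, hp.out.coprime_iff_not_dvd]
  intro h
  have h2 := hp.out.two_le
  have := Nat.le_of_dvd (by omega) h
  omega

variable [CharP k p]

/-- The Kummer covers of exponent `p - 1` are cyclic and tame. -/
theorem IsKummerCover.isCyclic_isTame {f : RatFunc k} (hf : f ≠ 0) {z : F}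
    (h : IsKummerCover p f z) :
    IsGalois (RatFunc k) F ∧ IsCyclic (F ≃ₐ[RatFunc k] F) ∧ IsTame k F p := by
  have : CharP (RatFunc k) p := charP_of_injective_algebraMap (algebraMap k _).injective p
  obtain ⟨χ, hχ, -⟩ := exists_kummer_character p hf h.1 h.2
  exact ⟨(isGalois_of_adjoin_eq_top p hf h.1 h.2).2, isCyclic_of_injective χ hχ,
    isTame_of_injective p χ hχ⟩

variable [IsScalarTower k (RatFunc k) F]

theorem pullback_smul_dt (s : F ≃ₐ[RatFunc k] F) (a : F) :
    pullback k F ((s : F →ₐ[RatFunc k] F).restrictScalars k) (a • dt k F) = s a • dt k F := by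
  unfold dt
  rw [pullback_smul_D]
  simp

/-- If `ω = ζ dt` belongs to a deformation datum, then `ζ` generates the cover: the Galois group
acts faithfully on `ω`. -/
theorem IsDeformationDatum.adjoin_eq_top {ζ : F} (h : IsDeformationDatum k p (ζ • dt k F)) :
    IntermediateField.adjoin (RatFunc k) {ζ} = ⊤ := by
  have := h.finite
  have := h.galois
  have : CharP F p := charP_of_injective_algebraMap (algebraMap k F).injective p
  obtain ⟨χ, hχ, hs⟩ := h.character
  refine adjoin_eq_top_of_stabilizer fun s hsζ => hχ ?_
  have h1 := hs s
  rw [pullback_smul_dt, hsζ] at h1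
  have h2 : (1 : F) • ζ • dt k F = (((χ s : (ZMod p)ˣ) : ZMod p).cast : F) • ζ • dt k F := by
    rw [one_smul]
    exact h1
  have h3 := smul_left_injective F h.ne_zero h2
  rw [map_one]
  refine Units.ext ((ZMod.castHom dvd_rfl F).injective ?_)
  rw [Units.val_one, map_one]
  exact h3.symm

/-- The form `ζ dt` with `ζ ^ (p - 1) = v⁻¹` on the cover generated by `ζ` is a deformation datum,
provided that `(d/dt)^{p-1} v = -1`. -/
theorem isDeformationDatum_of_adjoin_eq_top {ζ : F} {v : RatFunc k}
    (hgen : IntermediateField.adjoin (RatFunc k) {ζ} = ⊤)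
    (hζ : ζ ^ (p - 1) * algebraMap (RatFunc k) F v = 1)
    (hv : (ddt : Derivation k (RatFunc k) (RatFunc k))^[p - 1] v = -1) :
    IsDeformationDatum k p (ζ • dt k F) := by
  have : CharP (RatFunc k) p := charP_of_injective_algebraMap (algebraMap k _).injective p
  have hv0 : v ≠ 0 := by
    rintro rfl
    rw [map_zero, mul_zero] at hζ
    exact zero_ne_one hζ
  have hζv : ζ ^ (p - 1) = algebraMap (RatFunc k) F v⁻¹ := by
    rw [map_inv₀]
    exact eq_inv_of_mul_eq_one_left hζ
  have hζ0 : ζ ≠ 0 := by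
    rintro rfl
    rw [zero_pow (by have := hp.out.two_le; omega), zero_mul] at hζ
    exact zero_ne_one hζ
  obtain ⟨hfin, hgal⟩ := isGalois_of_adjoin_eq_top p (inv_ne_zero hv0) hgen hζv
  obtain ⟨χ, hχ, hχζ⟩ := exists_kummer_character p (inv_ne_zero hv0) hgen hζv
  exact
    { finite := hfin
      galois := hgal
      tame := isTame_of_injective p χ hχ
      ne_zero := smul_ne_zero hζ0 (exists_derivation_extension (k := k) (F := F)).1
      character := ⟨χ, hχ, fun s => by rw [pullback_smul_dt, hχζ, mul_smul]⟩
      logarithmic := exists_logarithmic p hv hζ }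

end Covers

/-! ### The `p`-curvature of a normalized nilpotent bundle -/

namespace FlatBundle

variable {k : Type u} [Field k] {S : Set (OnePoint k)} {V : Type v} [AddCommGroup V]
  [Module (RatFunc k) V] (E : FlatBundle S V)

section PCurvature

theorem pCurvature_smul (p : ℕ) [hp : Fact p.Prime] [CharP k p] (f : RatFunc k) (e : V) :
    E.pCurvature p (f • e) = f • E.pCurvature p e := by
  have : CharP (RatFunc k) p := charP_of_injective_algebraMap (algebraMap k _).injective p
  unfold pCurvature
  rw [iterate_char_leibniz p (ddt : Derivation k (RatFunc k) (RatFunc k)) E.nabla E.leibniz,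
    ddt_iterate_p, zero_smul, zero_add]

theorem pCurvature_add (p : ℕ) (e e' : V) :
    E.pCurvature p (e + e') = E.pCurvature p e + E.pCurvature p e' := by
  unfold pCurvature
  exact iterate_map_add E.nabla p e e'

theorem finrank_eq_two (E : FlatBundle S V) : Module.finrank (RatFunc k) V = 2 := by
  obtain ⟨b, -⟩ := E.exists_generic_frame
  rw [Module.finrank_eq_card_basis b, Fintype.card_fin]

theorem finrank_ker_eq_one (E : FlatBundle S V) {γ : V →ₗ[RatFunc k] RatFunc k} {e₀ : V}
    (he₀ : γ e₀ = 1) :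
    Module.finrank (RatFunc k) (LinearMap.ker γ) = 1 := by
  have : FiniteDimensional (RatFunc k) V :=
    FiniteDimensional.of_finrank_pos (by rw [finrank_eq_two E]; norm_num)
  have h1 := LinearMap.finrank_range_add_finrank_ker γ
  have h2 : LinearMap.range γ = ⊤ := by
    rw [LinearMap.range_eq_top]
    intro f
    exact ⟨f • e₀, by rw [map_smul, he₀, smul_eq_mul, mul_one]⟩
  rw [h2, finrank_top, Module.finrank_self, finrank_eq_two E] at h1
  omega

end PCurvature

variable {E}

theorem iterate_horizontal {γ : V →ₗ[RatFunc k] RatFunc k} (hγ : ∀ e, γ (E.nabla e) = ddt (γ e))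
    (n : ℕ) (e : V) :
    γ (E.nabla^[n] e) = (ddt : Derivation k (RatFunc k) (RatFunc k))^[n] (γ e) := by
  induction n with
  | zero => rfl
  | succ n ih => rw [Function.iterate_succ_apply', Function.iterate_succ_apply', hγ, ih]

/-- For a nilpotent bundle the `p`-curvature factors through any horizontal functional `γ ≠ 0`: it
maps to the kernel of `γ`, and it vanishes there because the kernel is a line. -/
theorem pCurvature_eq_smul (p : ℕ) [hp : Fact p.Prime] [CharP k p] (hnil : E.IsNilpotent p)
    {γ : V →ₗ[RatFunc k] RatFunc k} (hγ : ∀ e, γ (E.nabla e) = ddt (γ e)) {e₀ : V}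
    (he₀ : γ e₀ = 1) (e : V) : E.pCurvature p e = γ e • E.pCurvature p e₀ := by
  have hγΨ : ∀ e, γ (E.pCurvature p e) = 0 := fun e => by
    unfold pCurvature
    rw [iterate_horizontal hγ, ddt_iterate_p]
  have hker := finrank_ker_eq_one E he₀
  have hzero : ∀ n, γ n = 0 → E.pCurvature p n = 0 := by
    intro n hn
    by_contra hne
    have hn0 : n ≠ 0 := by
      rintro rfl
      apply hne
      have := E.pCurvature_smul p 0 (0 : V)
      rwa [smul_zero, zero_smul] at this
    obtain ⟨c, hc⟩ := (finrank_eq_one_iff_of_nonzero' (⟨n, hn⟩ : LinearMap.ker γ)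
      (fun h => hn0 (congrArg Subtype.val h))).1 hker ⟨E.pCurvature p n, hγΨ n⟩
    have hc' : E.pCurvature p n = c • n := (congrArg Subtype.val hc).symm
    have hc0 : c ≠ 0 := by
      rintro rfl
      rw [zero_smul] at hc'
      exact hne hc'
    obtain ⟨m, hm⟩ := hnil
    have hpow : ∀ j, (E.pCurvature p)^[j] n = c ^ j • n := by
      intro j
      induction j with
      | zero => simp
      | succ j ih =>
        rw [Function.iterate_succ_apply', ih, pCurvature_smul, hc', smul_smul, pow_succ]
    have := hm n
    rw [hpow] at this
    exact smul_ne_zero (pow_ne_zero _ hc0) hn0 this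
  have h1 : γ (e - γ e • e₀) = 0 := by
    rw [map_sub, map_smul, he₀, smul_eq_mul, mul_one, sub_self]
  have h2 : e = (e - γ e • e₀) + γ e • e₀ := by abel
  conv_lhs => rw [h2]
  rw [pCurvature_add, hzero _ h1, zero_add, pCurvature_smul]

theorem pCurvature_ne_zero (p : ℕ) [hp : Fact p.Prime] [CharP k p] (hnil : E.IsNilpotent p)
    (hact : E.IsActive p)
    {γ : V →ₗ[RatFunc k] RatFunc k} (hγ : ∀ e, γ (E.nabla e) = ddt (γ e)) {e₀ : V}
    (he₀ : γ e₀ = 1) : E.pCurvature p e₀ ≠ 0 := by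
  intro h0
  obtain ⟨e, he⟩ := hact
  rw [pCurvature_eq_smul p hnil hγ he₀, h0, smul_zero] at he
  exact he rfl

theorem nabla_pCurvature (p : ℕ) [hp : Fact p.Prime] [CharP k p] (hnil : E.IsNilpotent p)
    {γ : V →ₗ[RatFunc k] RatFunc k} (hγ : ∀ e, γ (E.nabla e) = ddt (γ e)) {e₀ : V}
    (he₀ : γ e₀ = 1) : E.nabla (E.pCurvature p e₀) = 0 := by
  have h1 : E.nabla (E.pCurvature p e₀) = E.pCurvature p (E.nabla e₀) := by
    unfold pCurvature
    exact (Function.iterate_succ_apply' E.nabla p e₀).symm.trans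
      (Function.iterate_succ_apply E.nabla p e₀)
  rw [h1, pCurvature_eq_smul p hnil hγ he₀, hγ, he₀, Derivation.map_one_eq_zero, zero_smul]

/-- The derivative of the canonical section is a multiple of its `p`-curvature: both lie in the
kernel of `γ`. -/
theorem exists_nabla_eq_smul (p : ℕ) [hp : Fact p.Prime] [CharP k p] (hnil : E.IsNilpotent p)
    (hact : E.IsActive p)
    {γ : V →ₗ[RatFunc k] RatFunc k} (hγ : ∀ e, γ (E.nabla e) = ddt (γ e)) {e₀ : V}
    (he₀ : γ e₀ = 1) : ∃ v : RatFunc k, E.nabla e₀ = v • (-E.pCurvature p e₀) := by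
  have hker := finrank_ker_eq_one E he₀
  have hη := pCurvature_ne_zero p hnil hact hγ he₀
  have hγη : γ (-E.pCurvature p e₀) = 0 := by
    unfold pCurvature
    rw [map_neg, iterate_horizontal hγ, ddt_iterate_p, neg_zero]
  have hγn : γ (E.nabla e₀) = 0 := by rw [hγ, he₀, Derivation.map_one_eq_zero]
  obtain ⟨c, hc⟩ := (finrank_eq_one_iff_of_nonzero' (⟨_, hγη⟩ : LinearMap.ker γ)
    (fun h => hη (neg_eq_zero.1 (congrArg Subtype.val h)))).1 hker ⟨_, hγn⟩
  exact ⟨c, (congrArg Subtype.val hc).symm⟩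

/-- The coefficient `v` in `∇ e₀ = -v Ψ(e₀)` satisfies `(d/dt)^{p-1} v = -1`: the section `Ψ(e₀)` is
horizontal, and `Ψ(e₀) = ∇^{p-1}(∇ e₀) = -(d/dt)^{p-1}(v) Ψ(e₀)`. -/
theorem iterate_ddt_eq_neg_one (p : ℕ) [hp : Fact p.Prime] [CharP k p] (hnil : E.IsNilpotent p)
    (hact : E.IsActive p)
    {γ : V →ₗ[RatFunc k] RatFunc k} (hγ : ∀ e, γ (E.nabla e) = ddt (γ e)) {e₀ : V}
    (he₀ : γ e₀ = 1) {v : RatFunc k} (hv : E.nabla e₀ = v • (-E.pCurvature p e₀)) :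
    (ddt : Derivation k (RatFunc k) (RatFunc k))^[p - 1] v = -1 := by
  set η := E.pCurvature p e₀ with hη
  have hη0 : η ≠ 0 := pCurvature_ne_zero p hnil hact hγ he₀
  have hηh : E.nabla η = 0 := nabla_pCurvature p hnil hγ he₀
  have hiter : ∀ n (f : RatFunc k), E.nabla^[n] (f • -η) =
      ((ddt : Derivation k (RatFunc k) (RatFunc k))^[n] f) • -η := by
    intro n
    induction n with
    | zero => intro f; rfl
    | succ n ih =>
      intro f
      rw [Function.iterate_succ_apply, Function.iterate_succ_apply, E.leibniz, map_neg, hηh,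
        neg_zero, smul_zero, add_zero, ih]
  have h1 : η = E.nabla^[p - 1] (E.nabla e₀) := by
    rw [hη, ← Function.iterate_succ_apply, Nat.succ_eq_add_one, Nat.sub_add_cancel hp.out.one_le]
    rfl
  rw [hv, hiter, smul_neg, ← neg_smul] at h1
  have h2 : (1 : RatFunc k) • η =
      (-(ddt : Derivation k (RatFunc k) (RatFunc k))^[p - 1] v) • η := by
    rw [one_smul]
    exact h1
  have h3 := smul_left_injective (RatFunc k) hη0 h2
  exact (neg_eq_iff_eq_neg.1 h3.symm)

/-! ### The Hodge filtration and the differential equation -/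

section Hodge

variable {L : Submodule (RatFunc k) V}

/-- By the Kodaira-Spencer isomorphism, a generator `e₁` of the Hodge filtration and its
logarithmic derivative span the stalk. -/
theorem mem_stalk_iff (hL : E.IsHodgeFiltration L) {e₁ : V}
    {a : k} (hgen : ∀ e : V, (e ∈ L ∧ e ∈ E.stalk (OnePoint.some a)) ↔
      ∃ f ∈ localRing (OnePoint.some a), e = f • e₁) (e : V) :
    e ∈ E.stalk (OnePoint.some a) ↔ ∃ f ∈ localRing (OnePoint.some a),
      ∃ g ∈ localRing (OnePoint.some a),
        e = f • e₁ + g • logCoeff S (OnePoint.some a) • E.nabla e₁ := by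
  set θ := logCoeff S (OnePoint.some a) with hθ
  have he₁ : e₁ ∈ L ∧ e₁ ∈ E.stalk (OnePoint.some a) :=
    (hgen e₁).2 ⟨1, Subring.one_mem _, (one_smul _ _).symm⟩
  have hreg : θ • E.nabla e₁ ∈ E.stalk (OnePoint.some a) := E.regular _ e₁ he₁.2
  have hsmul : ∀ f ∈ localRing (OnePoint.some a), ∀ e ∈ E.stalk (OnePoint.some a),
      f • e ∈ E.stalk (OnePoint.some a) :=
    fun f hf e he => (E.stalk (OnePoint.some a)).smul_mem ⟨f, hf⟩ he
  constructor
  · intro he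
    obtain ⟨e', he'L, he'S, hd⟩ := (hL.2 (OnePoint.some a)).2 e he
    obtain ⟨g, hg, rfl⟩ := (hgen e').1 ⟨he'L, he'S⟩
    have h1 : e - g • θ • E.nabla e₁ ∈ L := by
      have h2 : e - g • θ • E.nabla e₁ = (e - θ • E.nabla (g • e₁)) + (θ * ddt g) • e₁ := by
        rw [E.leibniz, smul_add, smul_smul, smul_smul, smul_smul, mul_comm g θ]
        abel
      rw [h2]
      exact L.add_mem hd (L.smul_mem _ he₁.1)
    obtain ⟨f, hf, hfe⟩ := (hgen _).1 ⟨h1, Submodule.sub_mem _ he (hsmul g hg _ hreg)⟩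
    exact ⟨f, hf, g, hg, by rw [← hfe]; abel⟩
  · rintro ⟨f, hf, g, hg, rfl⟩
    exact Submodule.add_mem _ (hsmul f hf _ he₁.2) (hsmul g hg _ hreg)

/-- A generator of the Hodge filtration and its derivative form a basis of the generic fibre. -/
theorem exists_basis_nabla (hL : E.IsHodgeFiltration L) {e₁ : V}
    {a : k} (hgen : ∀ e : V, (e ∈ L ∧ e ∈ E.stalk (OnePoint.some a)) ↔
      ∃ f ∈ localRing (OnePoint.some a), e = f • e₁) :
    ∃ b : Module.Basis (Fin 2) (RatFunc k) V, b 0 = e₁ ∧ b 1 = E.nabla e₁ := by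
  obtain ⟨b, hb⟩ := E.exists_frame (OnePoint.some a)
  have hspan : ⊤ ≤ Submodule.span (RatFunc k) (Set.range ![e₁, E.nabla e₁]) := by
    rw [← b.span_eq, Submodule.span_le]
    rintro _ ⟨i, rfl⟩
    have h1 : b i ∈ E.stalk (OnePoint.some a) := by
      rw [hb]
      exact Submodule.subset_span ⟨i, rfl⟩
    obtain ⟨f, -, g, -, h⟩ := (mem_stalk_iff hL hgen _).1 h1
    rw [SetLike.mem_coe, h]
    refine Submodule.add_mem _ (Submodule.smul_mem _ _ (Submodule.subset_span ⟨0, rfl⟩))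
      (Submodule.smul_mem _ _ (Submodule.smul_mem _ _ (Submodule.subset_span ⟨1, rfl⟩)))
  have hli := linearIndependent_of_top_le_span_of_card_eq_finrank hspan
    (by rw [finrank_eq_two E, Fintype.card_fin])
  exact ⟨Module.Basis.mk hli hspan, by simp, by simp⟩

/-- The logarithmic derivation relation for the coefficient `v` in `∇ e₀ = -v Ψ(e₀)`: if
`e₁ = w e₀` satisfies the differential equation with coefficients `P₁`, `P₂` then
`v' / v = -P₁ - 2 w' / w`. -/
theorem ddt_coeff_eq (p : ℕ) [hp : Fact p.Prime] [CharP k p] (hnil : E.IsNilpotent p)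
    (hact : E.IsActive p)
    {γ : V →ₗ[RatFunc k] RatFunc k} (hγ : ∀ e, γ (E.nabla e) = ddt (γ e)) {e₀ : V}
    (he₀ : γ e₀ = 1) {v : RatFunc k} (hv : E.nabla e₀ = v • (-E.pCurvature p e₀))
    {w P₁ P₂ : RatFunc k}
    (hode : E.nabla (E.nabla (w • e₀)) = -(P₂ • w • e₀) - P₁ • E.nabla (w • e₀)) :
    w * ddt v + 2 * ddt w * v + P₁ * w * v = 0 := by
  set η := E.pCurvature p e₀ with hη
  have hη0 : η ≠ 0 := pCurvature_ne_zero p hnil hact hγ he₀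
  have hηh : E.nabla η = 0 := nabla_pCurvature p hnil hγ he₀
  have hγη : γ η = 0 := by
    rw [hη]
    unfold pCurvature
    rw [iterate_horizontal hγ, ddt_iterate_p]
  have h1 : E.nabla (w • e₀) = ddt w • e₀ - (w * v) • η := by
    rw [E.leibniz, hv, smul_neg, smul_neg, mul_smul, sub_eq_add_neg]
  have h2 : E.nabla (E.nabla (w • e₀)) =
      ddt (ddt w) • e₀ - (2 * ddt w * v + w * ddt v) • η := by
    have hs : 2 * ddt w * v + w * ddt v = ddt w * v + (w * ddt v + v * ddt w) := by ring
    rw [h1, map_sub, E.leibniz, E.leibniz, hηh, hv, Derivation.leibniz, hs]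
    simp only [smul_eq_mul, smul_neg, smul_zero, add_zero, add_smul, mul_smul]
    abel
  have h3 : γ (E.nabla (E.nabla (w • e₀))) = -(P₂ * w) - P₁ * ddt w := by
    rw [hode, h1]
    simp only [map_sub, map_neg, map_smul, he₀, hγη, smul_eq_mul]
    ring
  have h4 : γ (E.nabla (E.nabla (w • e₀))) = ddt (ddt w) := by
    rw [h2]
    simp only [map_sub, map_smul, he₀, hγη, smul_eq_mul]
    ring
  have h5 : (2 * ddt w * v + w * ddt v) • η = (-(P₁ * (w * v))) • η := by
    have h6 : ddt (ddt w) • e₀ - (2 * ddt w * v + w * ddt v) • η =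
        (-(P₂ * w) - P₁ * ddt w) • e₀ - (-(P₁ * (w * v))) • η := by
      rw [← h2, hode, h1]
      simp only [smul_sub, sub_smul, neg_smul, mul_smul]
      abel
    rw [← h4.symm.trans h3] at h6
    exact sub_right_injective h6
  have h7 := smul_left_injective (RatFunc k) hη0 h5
  linear_combination h7

/-- Any rational solution of the differential equation is proportional to `γ(e₁)` over the
constants of `d/dt`, since it comes from another horizontal functional, which also kills the
`p`-curvature. -/
theorem wronskian_eq_zero (p : ℕ) [hp : Fact p.Prime] [CharP k p] (hnil : E.IsNilpotent p)
    (hact : E.IsActive p) {e₁ : V} (b : Module.Basis (Fin 2) (RatFunc k) V) (hb0 : b 0 = e₁)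
    (hb1 : b 1 = E.nabla e₁)
    {γ : V →ₗ[RatFunc k] RatFunc k} (hγ : ∀ e, γ (E.nabla e) = ddt (γ e)) (hγ0 : γ e₁ ≠ 0)
    {P₁ P₂ f : RatFunc k} (hode : E.nabla (E.nabla e₁) = -(P₂ • e₁) - P₁ • E.nabla e₁)
    (hf : ddt (ddt f) + P₁ * ddt f + P₂ * f = 0) :
    γ e₁ * ddt f = ddt (γ e₁) * f := by
  set w := γ e₁ with hw
  set e₀ := w⁻¹ • e₁ with he₀def
  have he₀ : γ e₀ = 1 := by
    rw [he₀def, map_smul, ← hw, smul_eq_mul, inv_mul_cancel₀ hγ0]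
  have he₁ : e₁ = w • e₀ := by rw [he₀def, smul_smul, mul_inv_cancel₀ hγ0, one_smul]
  obtain ⟨v, hv⟩ := exists_nabla_eq_smul p hnil hact hγ he₀
  -- the horizontal functional with `δ e₁ = f`
  let δ : V →ₗ[RatFunc k] RatFunc k := b.constr (RatFunc k) ![f, ddt f]
  have hδ0 : δ e₁ = f := by rw [← hb0, Module.Basis.constr_basis]; rfl
  have hδ1 : δ (E.nabla e₁) = ddt f := by rw [← hb1, Module.Basis.constr_basis]; rfl
  have hδ : ∀ e, δ (E.nabla e) = ddt (δ e) := by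
    intro e
    obtain ⟨c, d, rfl⟩ : ∃ c d : RatFunc k, e = c • e₁ + d • E.nabla e₁ := by
      refine ⟨b.repr e 0, b.repr e 1, ?_⟩
      conv_lhs => rw [← b.sum_repr e]
      rw [Fin.sum_univ_two, hb0, hb1]
    have h1 : E.nabla (c • e₁ + d • E.nabla e₁) = ddt c • e₁ + c • E.nabla e₁ +
        (ddt d • E.nabla e₁ + d • (-(P₂ • e₁) - P₁ • E.nabla e₁)) := by
      rw [map_add, E.leibniz, E.leibniz, hode]
    rw [h1]
    simp only [map_add, map_sub, map_neg, map_smul, hδ0, hδ1, smul_eq_mul, Derivation.leibniz]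
    linear_combination (-d) * hf
  have hδη : δ (E.pCurvature p e₀) = 0 := by
    unfold pCurvature
    rw [iterate_horizontal hδ, ddt_iterate_p]
  have h1 : E.nabla e₁ = ddt w • e₀ + w • v • (-E.pCurvature p e₀) := by
    rw [← hv, ← E.leibniz, ← he₁]
  have h2 : δ (E.nabla e₁) = ddt w * (w⁻¹ * f) := by
    have h3 : δ e₀ = w⁻¹ * f := by rw [he₀def, map_smul, hδ0, smul_eq_mul]
    rw [h1]
    simp only [map_add, map_smul, map_neg, hδη, h3, smul_eq_mul]
    ring
  rw [hδ1] at h2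
  rw [h2]
  field_simp

end Hodge

end FlatBundle

/-! ### The order of vanishing of the `p`-curvature -/

namespace FlatBundle

variable {k : Type u} [Field k] {S : Set (OnePoint k)} {V : Type v} [AddCommGroup V]
  [Module (RatFunc k) V] {E : FlatBundle S V} {L : Submodule (RatFunc k) V}

theorem logCoeff_of_mem {a : k} (ha : OnePoint.some a ∈ S) :
    logCoeff S (OnePoint.some a) = RatFunc.X - RatFunc.C a := by
  simp only [logCoeff, if_pos ha]

theorem logCoeff_of_notMem {a : k} (ha : OnePoint.some a ∉ S) :
    logCoeff S (OnePoint.some a) = 1 := by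
  simp only [logCoeff, if_neg ha]

theorem logCoeff_ne_zero (a : k) : logCoeff S (OnePoint.some a) ≠ 0 := by
  by_cases ha : OnePoint.some a ∈ S
  · rw [logCoeff_of_mem ha]
    exact X_sub_C_ne_zero a
  · rw [logCoeff_of_notMem ha]
    exact one_ne_zero

theorem logCoeff_mem_localRing (a : k) :
    logCoeff S (OnePoint.some a) ∈ localRing (OnePoint.some a) := by
  by_cases ha : OnePoint.some a ∈ S
  · rw [logCoeff_of_mem ha]
    exact localParam_mem_localRing a
  · rw [logCoeff_of_notMem ha]
    exact Subring.one_mem _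

variable {γ : V →ₗ[RatFunc k] RatFunc k} {e₁ : V} {a : k}

/-- Since `γ` is surjective on stalks, `γ(e₁)` and its logarithmic derivative generate the unit
ideal of the local ring. -/
theorem IsNormalization.exists_combination (hγ : E.IsNormalization γ)
    (hL : E.IsHodgeFiltration L)
    (hgen : ∀ e : V, (e ∈ L ∧ e ∈ E.stalk (OnePoint.some a)) ↔
      ∃ f ∈ localRing (OnePoint.some a), e = f • e₁) :
    ∃ f ∈ localRing (OnePoint.some a), ∃ g ∈ localRing (OnePoint.some a),
      f * γ e₁ + g * (logCoeff S (OnePoint.some a) * ddt (γ e₁)) = 1 := by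
  have h1 : (1 : RatFunc k) ∈ γ '' (E.stalk (OnePoint.some a) : Set V) := by
    rw [hγ.2]
    exact Subring.one_mem _
  obtain ⟨e, he, he1⟩ := h1
  obtain ⟨f, hf, g, hg, rfl⟩ := (mem_stalk_iff hL hgen e).1 he
  refine ⟨f, hf, g, hg, ?_⟩
  rw [← he1, map_add, map_smul, map_smul, map_smul, hγ.1, smul_eq_mul, smul_eq_mul, smul_eq_mul]

theorem IsNormalization.apply_ne_zero (hγ : E.IsNormalization γ) (hL : E.IsHodgeFiltration L)
    (hgen : ∀ e : V, (e ∈ L ∧ e ∈ E.stalk (OnePoint.some a)) ↔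
      ∃ f ∈ localRing (OnePoint.some a), e = f • e₁) : γ e₁ ≠ 0 := by
  intro h0
  obtain ⟨f, -, g, -, h⟩ := hγ.exists_combination hL hgen
  rw [h0, map_zero] at h
  simp at h

theorem IsNormalization.apply_mem_localRing (hγ : E.IsNormalization γ)
    (hgen : ∀ e : V, (e ∈ L ∧ e ∈ E.stalk (OnePoint.some a)) ↔
      ∃ f ∈ localRing (OnePoint.some a), e = f • e₁) : γ e₁ ∈ localRing (OnePoint.some a) := by
  have h1 : γ e₁ ∈ (localRing (OnePoint.some a) : Set (RatFunc k)) := by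
    rw [← hγ.2]
    exact ⟨e₁, ((hgen e₁).2 ⟨1, Subring.one_mem _, (one_smul _ _).symm⟩).2, rfl⟩
  exact h1

/-- `γ(e₁)` has no zeros at the marked points. -/
theorem IsNormalization.ordAt_eq_zero (hγ : E.IsNormalization γ) (hL : E.IsHodgeFiltration L)
    (hgen : ∀ e : V, (e ∈ L ∧ e ∈ E.stalk (OnePoint.some a)) ↔
      ∃ f ∈ localRing (OnePoint.some a), e = f • e₁) (ha : OnePoint.some a ∈ S) :
    ordAt a (γ e₁) = 0 := by
  have hw := hγ.apply_ne_zero hL hgen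
  have hwm := hγ.apply_mem_localRing hgen
  have h0 := (ordAt_nonneg_iff hw).2 hwm
  by_contra hne
  obtain ⟨g', hg', hwg⟩ := exists_eq_pow_mul (a := a) (n := 1) hw (by push_cast; omega)
  obtain ⟨f, hf, g, hg, h⟩ := hγ.exists_combination hL hgen
  rw [logCoeff_of_mem ha] at h
  refine not_mul_eq_one_of_mem_localRing (a := a) (f := f * g' + g * ddt (γ e₁))
    (Subring.add_mem _ (Subring.mul_mem _ hf hg') (Subring.mul_mem _ hg (ddt_mem_localRing hwm)))
    ?_
  rw [← h]
  linear_combination -f * hwg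

/-- `γ(e₁)` has at most simple zeros at the unmarked points. -/
theorem IsNormalization.ordAt_le_one (hγ : E.IsNormalization γ) (hL : E.IsHodgeFiltration L)
    (hgen : ∀ e : V, (e ∈ L ∧ e ∈ E.stalk (OnePoint.some a)) ↔
      ∃ f ∈ localRing (OnePoint.some a), e = f • e₁) (ha : OnePoint.some a ∉ S) :
    ordAt a (γ e₁) ≤ 1 := by
  have hw := hγ.apply_ne_zero hL hgen
  by_contra hne
  obtain ⟨g', hg', hwg⟩ := exists_eq_pow_mul (a := a) (n := 2) hw (by push_cast; omega)
  obtain ⟨f, hf, g, hg, h⟩ := hγ.exists_combination hL hgen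
  rw [logCoeff_of_notMem ha] at h
  have hs : RatFunc.X - RatFunc.C a ∈ localRing (OnePoint.some a) := localParam_mem_localRing a
  have hd : ddt (γ e₁) = (RatFunc.X - RatFunc.C a) *
      (2 * g' + (RatFunc.X - RatFunc.C a) * ddt g') := by
    rw [hwg, Derivation.leibniz, Derivation.leibniz_pow, ddt_X_sub_C]
    simp only [smul_eq_mul, nsmul_eq_mul]
    push_cast
    ring
  refine not_mul_eq_one_of_mem_localRing (a := a)
    (f := f * (RatFunc.X - RatFunc.C a) * g' + g * (2 * g' + (RatFunc.X - RatFunc.C a) * ddt g'))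
    (Subring.add_mem _ (Subring.mul_mem _ (Subring.mul_mem _ hf hs) hg')
      (Subring.mul_mem _ hg (Subring.add_mem _ (by
        rw [two_mul]
        exact Subring.add_mem _ hg' hg')
        (Subring.mul_mem _ hs (ddt_mem_localRing hg'))))) ?_
  rw [← h]
  linear_combination -f * hwg - g * hd

/-- The order of vanishing of the `p`-curvature in terms of the coefficient `v` in
`∇ e₀ = -v Ψ(e₀)`. With `w = γ(e₁)` and `θ = logCoeff`, the section `θ^p Ψ(e₀)` is
`θ^{p-1} / (v w²)` times a primitive section of the stalk. -/
theorem mem_spikeOrder_set_iff (p : ℕ) [hp : Fact p.Prime] [CharP k p] (hnil : E.IsNilpotent p)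
    (hγ : E.IsNormalization γ) (hL : E.IsHodgeFiltration L)
    (hgen : ∀ e : V, (e ∈ L ∧ e ∈ E.stalk (OnePoint.some a)) ↔
      ∃ f ∈ localRing (OnePoint.some a), e = f • e₁) {e₀ : V} (he : e₁ = γ e₁ • e₀)
    {v : RatFunc k} (hv0 : v ≠ 0) (hv : E.nabla e₀ = v • (-E.pCurvature p e₀)) (n : ℕ) :
    (∀ e ∈ E.stalk (OnePoint.some a), ∃ e' ∈ E.stalk (OnePoint.some a),
      logCoeff S (OnePoint.some a) ^ p • E.pCurvature p e = localParam (OnePoint.some a) ^ n • e') ↔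
    (n : ℤ) ≤ ordAt a (logCoeff S (OnePoint.some a) ^ (p - 1) * (v * γ e₁ ^ 2)⁻¹) := by
  obtain ⟨b, hb0, hb1⟩ := exists_basis_nabla hL hgen
  have hw := hγ.apply_ne_zero hL hgen
  have hwm := hγ.apply_mem_localRing hgen
  obtain ⟨f, hf, g, hg, hfg⟩ := hγ.exists_combination hL hgen
  have hθm : logCoeff S (OnePoint.some a) ∈ localRing (OnePoint.some a) :=
    logCoeff_mem_localRing a
  have hθ0 : logCoeff S (OnePoint.some a) ≠ 0 := logCoeff_ne_zero a
  have hstalk := mem_stalk_iff hL hgen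
  change (∀ e ∈ E.stalk (OnePoint.some a), ∃ e' ∈ E.stalk (OnePoint.some a),
      logCoeff S (OnePoint.some a) ^ p • E.pCurvature p e =
        (RatFunc.X - RatFunc.C a) ^ n • e') ↔ _
  have hγ1 := hγ.1
  have himage : γ '' (E.stalk (OnePoint.some a) : Set V) = localRing (OnePoint.some a) :=
    hγ.2 (OnePoint.some a)
  generalize logCoeff S (OnePoint.some a) = θ at *
  set w := γ e₁ with hwdef
  have he₀ : γ e₀ = 1 := by
    have h1 := congrArg γ he
    rw [map_smul, ← hwdef, smul_eq_mul] at h1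
    exact (mul_right_eq_self₀.1 h1.symm).resolve_right hw
  set s : RatFunc k := RatFunc.X - RatFunc.C a with hs
  have hs0 : s ≠ 0 := X_sub_C_ne_zero a
  set h := θ ^ (p - 1) * (v * w ^ 2)⁻¹ with hh
  have hh0 : h ≠ 0 := mul_ne_zero (pow_ne_zero _ hθ0)
    (inv_ne_zero (mul_ne_zero hv0 (pow_ne_zero _ hw)))
  have hη : θ ^ p • E.pCurvature p e₀ = (h * (θ * ddt w)) • e₁ + (-(h * w) * θ) • E.nabla e₁ := by
    have h1 : E.nabla e₁ = ddt w • e₀ - (w * v) • E.pCurvature p e₀ := by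
      conv_lhs => rw [he]
      rw [E.leibniz, hv, smul_neg, smul_neg, mul_smul, sub_eq_add_neg]
    have hθp : θ ^ p = θ ^ (p - 1) * θ := by
      rw [← pow_succ, Nat.sub_add_cancel hp.out.one_le]
    have h2 : θ ^ p = h * w * θ * (w * v) := by
      rw [hθp, hh]
      field_simp
    have h3 : (h * (θ * ddt w)) * w = h * w * θ * ddt w := by ring
    rw [h1]
    conv_rhs => enter [1]; rw [he]
    rw [smul_smul, h3, neg_mul, neg_smul, smul_sub, smul_smul, smul_smul, ← h2]
    abel
  have hΨ : ∀ e, θ ^ p • E.pCurvature p e =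
      (γ e * h * (θ * ddt w)) • e₁ + (-(γ e * h * w) * θ) • E.nabla e₁ := by
    intro e
    have e1 : γ e * h * (θ * ddt w) = γ e * (h * (θ * ddt w)) := by ring
    have e2 : -(γ e * h * w) * θ = γ e * (-(h * w) * θ) := by ring
    rw [pCurvature_eq_smul p hnil hγ1 he₀ e, smul_comm, hη, smul_add, smul_smul, smul_smul, e1, e2]
  constructor
  · intro H
    have h1 : (1 : RatFunc k) ∈ γ '' (E.stalk (OnePoint.some a) : Set V) := by
      rw [himage]
      exact Subring.one_mem _
    obtain ⟨e, hes, he1⟩ := h1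
    obtain ⟨e', he's, hee'⟩ := H e hes
    obtain ⟨f', hf', g', hg', rfl⟩ := (hstalk e').1 he's
    rw [hΨ, he1, smul_add, smul_smul, smul_smul, smul_smul, ← hb1, ← hb0] at hee'
    have h2 := congrArg (b.coord 0) hee'
    have h3 := congrArg (b.coord 1) hee'
    simp at h2 h3
    have h4 : -(h * w) = s ^ n * g' := by
      apply mul_right_cancel₀ hθ0
      linear_combination h3
    -- the coordinates `θ w'` and `-w` of the primitive section generate the unit ideal
    have h5 : h = s ^ n * (g * f' - f * g') := by
      linear_combination (-h) * hfg + g * h2 - f * h4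
    have hq0 : g * f' - f * g' ≠ 0 := by
      intro h0
      rw [h0, mul_zero] at h5
      exact hh0 h5
    rw [h5, ordAt_mul a (pow_ne_zero n hs0) hq0, ordAt_pow a hs0, ordAt_X_sub_C_self]
    have := (ordAt_nonneg_iff hq0).2
      (Subring.sub_mem _ (Subring.mul_mem _ hg hf') (Subring.mul_mem _ hf hg'))
    omega
  · intro H e hes
    obtain ⟨h', hh', hhs⟩ := exists_eq_pow_mul hh0 H
    have hγe : γ e ∈ localRing (OnePoint.some a) := by
      have h1 : γ e ∈ γ '' (E.stalk (OnePoint.some a) : Set V) := ⟨e, hes, rfl⟩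
      rw [himage] at h1
      exact h1
    refine ⟨(γ e * h' * (θ * ddt w)) • e₁ + (-(γ e * h' * w)) • θ • E.nabla e₁,
      (hstalk _).2 ⟨_, Subring.mul_mem _ (Subring.mul_mem _ hγe hh')
        (Subring.mul_mem _ hθm (ddt_mem_localRing hwm)), _,
        Subring.neg_mem _ (Subring.mul_mem _ (Subring.mul_mem _ hγe hh') hwm), rfl⟩, ?_⟩
    have e1 : γ e * h * (θ * ddt w) = s ^ n * (γ e * h' * (θ * ddt w)) := by
      linear_combination (γ e * (θ * ddt w)) * hhs
    have e2 : -(γ e * h * w) * θ = s ^ n * (-(γ e * h' * w)) * θ := by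
      linear_combination (-γ e * w * θ) * hhs
    rw [hΨ, e1, e2, smul_add, smul_smul, smul_smul, smul_smul]

/-- The order of vanishing of the `p`-curvature is the order of `θ^{p-1} / (v w²)`, provided that
the latter is not negative. -/
theorem spikeOrder_eq_toNat (p : ℕ) [hp : Fact p.Prime] [CharP k p] (hnil : E.IsNilpotent p)
    (hγ : E.IsNormalization γ) (hL : E.IsHodgeFiltration L)
    (hgen : ∀ e : V, (e ∈ L ∧ e ∈ E.stalk (OnePoint.some a)) ↔
      ∃ f ∈ localRing (OnePoint.some a), e = f • e₁) {e₀ : V} (he : e₁ = γ e₁ • e₀)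
    {v : RatFunc k} (hv0 : v ≠ 0) (hv : E.nabla e₀ = v • (-E.pCurvature p e₀)) :
    E.spikeOrder p (OnePoint.some a) =
      (ordAt a (logCoeff S (OnePoint.some a) ^ (p - 1) * (v * γ e₁ ^ 2)⁻¹)).toNat := by
  unfold spikeOrder
  simp only [mem_spikeOrder_set_iff p hnil hγ hL hgen he hv0 hv]
  generalize ordAt a _ = m
  rcases le_or_gt 0 m with hm | hm
  · have h1 : {n : ℕ | (n : ℤ) ≤ m} = Set.Iic m.toNat := by
      ext n
      simp only [Set.mem_ofPred_eq, Set.mem_Iic]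
      omega
    rw [h1, csSup_Iic]
  · -- the set is empty, with junk supremum `0`
    have h1 : {n : ℕ | (n : ℤ) ≤ m} = ∅ := by
      ext n
      simp only [Set.mem_ofPred_eq, Set.mem_empty_iff_false, iff_false]
      omega
    rw [h1, Int.toNat_of_nonpos hm.le]
    simp

/-- At an unmarked point the `p`-curvature is regular, as the stalk is stable under `∇`. -/
theorem ordAt_nonneg_of_notMem (p : ℕ) [hp : Fact p.Prime] [CharP k p] (hnil : E.IsNilpotent p)
    (hγ : E.IsNormalization γ) (hL : E.IsHodgeFiltration L)
    (hgen : ∀ e : V, (e ∈ L ∧ e ∈ E.stalk (OnePoint.some a)) ↔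
      ∃ f ∈ localRing (OnePoint.some a), e = f • e₁) {e₀ : V} (he : e₁ = γ e₁ • e₀)
    {v : RatFunc k} (hv0 : v ≠ 0) (hv : E.nabla e₀ = v • (-E.pCurvature p e₀))
    (ha : OnePoint.some a ∉ S) :
    0 ≤ ordAt a (logCoeff S (OnePoint.some a) ^ (p - 1) * (v * γ e₁ ^ 2)⁻¹) := by
  have h1 := (mem_spikeOrder_set_iff p hnil hγ hL hgen he hv0 hv 0).1 (fun e hes => by
    refine ⟨E.pCurvature p e, ?_, ?_⟩
    · unfold pCurvature
      have : ∀ n, E.nabla^[n] e ∈ E.stalk (OnePoint.some a) := by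
        intro n
        induction n with
        | zero => exact hes
        | succ n ih =>
          rw [Function.iterate_succ_apply']
          have := E.regular _ _ ih
          rwa [logCoeff_of_notMem ha, one_smul] at this
      exact this p
    · rw [logCoeff_of_notMem ha, one_pow, one_smul, pow_zero, one_smul])
  exact_mod_cast h1

end FlatBundle

/-! ### Products of powers of linear factors -/

section Products

variable {k : Type u} [Field k]

theorem prod_zpow_ne_zero {ι : Type*} (s : Finset ι) (x : ι → k) (m : ι → ℤ) :
    ∏ i ∈ s, (RatFunc.X - RatFunc.C (x i) : RatFunc k) ^ m i ≠ 0 :=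
  Finset.prod_ne_zero_iff.2 fun i _ => zpow_ne_zero _ (X_sub_C_ne_zero (x i))

open Classical in
theorem ordAt_prod_zpow {ι : Type*} (s : Finset ι) (x : ι → k) (m : ι → ℤ) (a : k) :
    ordAt a (∏ i ∈ s, (RatFunc.X - RatFunc.C (x i) : RatFunc k) ^ m i) =
      ∑ i ∈ s, if a = x i then m i else 0 := by
  rw [ordAt_prod a s _ fun i _ => zpow_ne_zero _ (X_sub_C_ne_zero (x i))]
  refine Finset.sum_congr rfl fun i _ => ?_
  rw [ordAt_zpow a (X_sub_C_ne_zero (x i))]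
  split_ifs with h
  · rw [h, ordAt_X_sub_C_self, mul_one]
  · rw [ordAt_X_sub_C_of_ne h, mul_zero]

theorem ordAt_prod_zpow_apply {ι : Type*} {s : Finset ι} {x : ι → k}
    (hx : Function.Injective x) (m : ι → ℤ) {j : ι} (hj : j ∈ s) :
    ordAt (x j) (∏ i ∈ s, (RatFunc.X - RatFunc.C (x i) : RatFunc k) ^ m i) = m j := by
  classical
  rw [ordAt_prod_zpow, Finset.sum_eq_single j (fun i _ hne => if_neg fun h => hne (hx h).symm)
    fun h => absurd hj h, if_pos rfl]

theorem ordAt_prod_zpow_of_ne {ι : Type*} {s : Finset ι} {x : ι → k} (m : ι → ℤ) {a : k}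
    (ha : ∀ i ∈ s, a ≠ x i) :
    ordAt a (∏ i ∈ s, (RatFunc.X - RatFunc.C (x i) : RatFunc k) ^ m i) = 0 := by
  classical
  rw [ordAt_prod_zpow]
  exact Finset.sum_eq_zero fun i hi => if_neg (ha i hi)

/-- The logarithmic derivative of a product of powers of linear factors. -/
theorem ddt_prod_zpow {ι : Type*} (s : Finset ι) (x : ι → k) (m : ι → ℤ) :
    ddt (∏ i ∈ s, (RatFunc.X - RatFunc.C (x i) : RatFunc k) ^ m i) =
      (∑ i ∈ s, RatFunc.C (m i : k) / (RatFunc.X - RatFunc.C (x i))) *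
        ∏ i ∈ s, (RatFunc.X - RatFunc.C (x i) : RatFunc k) ^ m i := by
  classical
  induction s using Finset.induction_on with
  | empty => simp
  | insert j s hj ih =>
    have hs := X_sub_C_ne_zero (x j)
    rw [Finset.prod_insert hj, Finset.sum_insert hj, Derivation.leibniz, ih, ddt_zpow hs,
      ddt_X_sub_C, zpow_sub_one₀ hs, map_intCast]
    simp only [smul_eq_mul]
    ring

end Products

theorem mem_marked_some {k : Type u} {r : ℕ} {x : Fin (r - 1) → k} {a : k} :
    OnePoint.some a ∈ marked x ↔ ∃ i, a = x i := by
  unfold marked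
  simp only [Set.mem_ofPred_eq]
  constructor
  · rintro (h | ⟨i, hi⟩)
    · exact absurd h (OnePoint.coe_ne_infty a)
    · exact ⟨i, OnePoint.coe_injective hi⟩
  · rintro ⟨i, rfl⟩
    exact Or.inr ⟨i, rfl⟩

section Solution

variable {k : Type u} [Field k] {p : ℕ} {r : ℕ} {σ : Signature k p} {x : Fin (r - 1) → k}
  {β : Fin (r - 3) → k} {U : k[X]}

theorem funQ_ne_zero : funQ σ x ≠ 0 := prod_zpow_ne_zero _ _ _

theorem ddt_funQ : ddt (funQ σ x) = coeffP1 σ x * funQ σ x := by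
  unfold funQ coeffP1
  rw [ddt_prod_zpow]
  simp only [Int.cast_sub, Int.cast_one, Int.cast_natCast]

namespace IsStrongSolution

theorem ne_zero (h : IsStrongSolution σ x β U) : U ≠ 0 := by
  rintro rfl
  have := h.degree
  have := σ.d_pos
  simp at *
  omega

theorem algebraMap_ne_zero (h : IsStrongSolution σ x β U) :
    algebraMap k[X] (RatFunc k) U ≠ 0 := RatFunc.algebraMap_ne_zero h.ne_zero

theorem ordAt_eq_zero (h : IsStrongSolution σ x β U) {a : k} (ha : OnePoint.some a ∈ σ.M) :
    ordAt a (algebraMap k[X] (RatFunc k) U) = 0 := by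
  rw [ordAt_algebraMap a h.ne_zero, Polynomial.rootMultiplicity_eq_zero (h.eval_ne_zero a ha)]
  rfl

theorem mem_M (h : IsStrongSolution σ x β U) (i : Fin (r - 1)) : OnePoint.some (x i) ∈ σ.M :=
  ((h.singularity _).2 (mem_marked_some.2 ⟨i, rfl⟩)).1

theorem ordAt_nonneg (h : IsStrongSolution σ x β U) (a : k) :
    0 ≤ ordAt a (algebraMap k[X] (RatFunc k) U) := by
  rw [ordAt_algebraMap a h.ne_zero]
  omega

theorem ordAt_le_one (h : IsStrongSolution σ x β U) (a : k) :
    ordAt a (algebraMap k[X] (RatFunc k) U) ≤ 1 := by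
  rw [ordAt_algebraMap a h.ne_zero]
  exact_mod_cast h.simple_zeros a

end IsStrongSolution

/-! ### The canonical section and the polynomial solution -/

variable {V : Type v} [AddCommGroup V] [Module (RatFunc k) V] {E : FlatBundle (marked x) V}
  {L : Submodule (RatFunc k) V} {γ : V →ₗ[RatFunc k] RatFunc k} {e₁ : V}

/-- The image of the generator of the Hodge filtration under a normalization is a constant multiple
of the polynomial solution: the quotient is a constant of `d/dt`, so its orders are divisible by
`p`, and they lie between `-1` and `1`. -/
theorem exists_apply_eq_const_mul [IsAlgClosed k] [hp : Fact p.Prime] [CharP k p]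
    (hsol : IsStrongSolution σ x β U) (hact : E.IsActive p) (hnil : E.IsNilpotent p)
    (hL : E.IsHodgeFiltration L)
    (hgen : ∀ a : k, ∀ e : V, (e ∈ L ∧ e ∈ E.stalk (OnePoint.some a)) ↔
      ∃ f ∈ localRing (OnePoint.some a), e = f • e₁)
    (hode : E.nabla (E.nabla e₁) = -(coeffP2 σ x β • e₁) - coeffP1 σ x • E.nabla e₁)
    (hγ : E.IsNormalization γ) :
    ∃ c : k, c ≠ 0 ∧ γ e₁ = RatFunc.C c * algebraMap k[X] (RatFunc k) U := by
  obtain ⟨b, hb0, hb1⟩ := FlatBundle.exists_basis_nabla hL (hgen 0)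
  have hw := hγ.apply_ne_zero hL (hgen 0)
  have hu := hsol.algebraMap_ne_zero
  set f := algebraMap k[X] (RatFunc k) U with hf
  have hW := FlatBundle.wronskian_eq_zero p hnil hact b hb0 hb1 hγ.1 hw hode hsol.equation
  set w := γ e₁ with hwdef
  have hg0 : w / f ≠ 0 := div_ne_zero hw hu
  have hgf : w / f * f = w := div_mul_cancel₀ w hu
  have hdg : ddt (w / f) = 0 := by
    have h1 := congrArg ddt hgf
    rw [Derivation.leibniz] at h1
    simp only [smul_eq_mul] at h1
    have h2 : f ^ 2 * ddt (w / f) = 0 := by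
      have h3 : f * (w / f) = w := mul_div_cancel₀ w hu
      linear_combination f * h1 - hW - ddt f * h3
    exact (mul_eq_zero.1 h2).resolve_left (pow_ne_zero 2 hu)
  have hord : ∀ a, ordAt a (w / f) = 0 := by
    intro a
    have h1 := ordAt_cast_eq_zero_of_ddt_eq_zero a hg0 hdg
    rw [div_eq_mul_inv, ordAt_mul a hw (inv_ne_zero hu), ordAt_inv] at h1 ⊢
    have hu0 := hsol.ordAt_nonneg a
    have hu1 := hsol.ordAt_le_one a
    have hw0 := (ordAt_nonneg_iff hw).2 (hγ.apply_mem_localRing (hgen a))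
    rw [← hf] at hu0 hu1
    have hw1 : ordAt a w ≤ 1 := by
      by_cases ha : OnePoint.some a ∈ marked x
      · exact (hγ.ordAt_eq_zero hL (hgen a) ha).le.trans zero_le_one
      · exact hγ.ordAt_le_one hL (hgen a) ha
    have hcases : ordAt a w + -ordAt a f = -1 ∨ ordAt a w + -ordAt a f = 0 ∨
        ordAt a w + -ordAt a f = 1 := by omega
    rcases hcases with h | h | h
    · rw [h] at h1
      simp at h1
    · exact h
    · rw [h] at h1
      simp at h1
  obtain ⟨c, hc, hcw⟩ := exists_const_of_ordAt_eq_zero hg0 hord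
  exact ⟨c, hc, by rw [← hcw, hgf]⟩

/-- The coefficient `v` in `∇ e₀ = -v Ψ(e₀)` is determined by the polynomial solution. The
differential equation says that `v Q u²` is a constant of `d/dt`, and this constant is determined
by `(d/dt)^{p-1} v = -1`. -/
theorem coeff_mul_eq_neg_one [IsAlgClosed k] [hp : Fact p.Prime] [CharP k p]
    (hsol : IsStrongSolution σ x β U) (hact : E.IsActive p) (hnil : E.IsNilpotent p)
    (hL : E.IsHodgeFiltration L)
    (hgen : ∀ a : k, ∀ e : V, (e ∈ L ∧ e ∈ E.stalk (OnePoint.some a)) ↔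
      ∃ f ∈ localRing (OnePoint.some a), e = f • e₁)
    (hode : E.nabla (E.nabla e₁) = -(coeffP2 σ x β • e₁) - coeffP1 σ x • E.nabla e₁)
    (hγ : E.IsNormalization γ) {e₀ : V} (he : e₁ = γ e₁ • e₀) (he₀ : γ e₀ = 1)
    {v : RatFunc k} (hv : E.nabla e₀ = v • (-E.pCurvature p e₀)) :
    v * (funQ σ x * algebraMap k[X] (RatFunc k) U ^ 2) *
      (ddt : Derivation k (RatFunc k) (RatFunc k))^[p - 1]
        (funQ σ x * algebraMap k[X] (RatFunc k) U ^ 2)⁻¹ = -1 := by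
  obtain ⟨c, hc, hcw⟩ := exists_apply_eq_const_mul hsol hact hnil hL hgen hode hγ
  have hu := hsol.algebraMap_ne_zero
  set f := algebraMap k[X] (RatFunc k) U with hf
  have hQ : funQ σ x ≠ 0 := funQ_ne_zero
  have hddtC : ddt (RatFunc.C c) = 0 := by
    rw [← RatFunc.algebraMap_C, ddt_algebraMap]
    simp
  have hC0 : RatFunc.C c ≠ 0 := by rwa [Ne, map_eq_zero]
  have hode' : E.nabla (E.nabla (γ e₁ • e₀)) =
      -(coeffP2 σ x β • γ e₁ • e₀) - coeffP1 σ x • E.nabla (γ e₁ • e₀) := by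
    rw [← he]
    exact hode
  have h1 := FlatBundle.ddt_coeff_eq p hnil hact hγ.1 he₀ hv hode'
  rw [hcw, Derivation.leibniz, hddtC, smul_zero, add_zero, smul_eq_mul] at h1
  have h2 : f * ddt v + 2 * ddt f * v + coeffP1 σ x * f * v = 0 := by
    apply mul_left_cancel₀ hC0
    linear_combination h1
  have h3 : ddt (v * (funQ σ x * f ^ 2)) = 0 := by
    rw [Derivation.leibniz, Derivation.leibniz, Derivation.leibniz_pow, ddt_funQ]
    simp only [smul_eq_mul, nsmul_eq_mul]
    push_cast
    linear_combination (funQ σ x * f) * h2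
  rw [← iterate_ddt_mul h3, mul_inv_cancel_right₀ (mul_ne_zero hQ (pow_ne_zero 2 hu)),
    FlatBundle.iterate_ddt_eq_neg_one p hnil hact hγ.1 he₀ hv]

end Solution

/-! ### The divisor of the coefficient `v` -/

section Divisor

variable {k : Type u} [Field k] {p : ℕ} {r : ℕ} {σ : Signature k p} {x : Fin (r - 1) → k}
  {β : Fin (r - 3) → k} {U : k[X]} {V : Type v} [AddCommGroup V] [Module (RatFunc k) V]
  {E : FlatBundle (marked x) V}
  {L : Submodule (RatFunc k) V} {γ : V →ₗ[RatFunc k] RatFunc k} {e₁ e₀ : V} {v : RatFunc k}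

theorem radicand_ne_zero (hsol : IsStrongSolution σ x β U) (E : FlatBundle (marked x) V)
    (spk : Finset k) : radicand p x E spk U ≠ 0 := by
  unfold radicand
  refine mul_ne_zero (mul_ne_zero ?_ ?_) (pow_ne_zero 2 hsol.algebraMap_ne_zero)
  · exact Finset.prod_ne_zero_iff.2 fun i _ => pow_ne_zero _ (X_sub_C_ne_zero _)
  · exact Finset.prod_ne_zero_iff.2 fun i _ => pow_ne_zero _ (X_sub_C_ne_zero _)

theorem formDenom_ne_zero (p : ℕ) (E : FlatBundle (marked x) V) (spk : Finset k) :
    formDenom p x E spk ≠ 0 :=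
  mul_ne_zero (prod_zpow_ne_zero _ _ _) (prod_zpow_ne_zero _ _ _)

variable [IsAlgClosed k] [hp : Fact p.Prime] [CharP k p]

/-- The orders of `v` and of the `p`-curvature at the finite points. -/
theorem ordAt_coeff (hsol : IsStrongSolution σ x β U) (hact : E.IsActive p)
    (hnil : E.IsNilpotent p) (hL : E.IsHodgeFiltration L)
    (hgen : ∀ a : k, ∀ e : V, (e ∈ L ∧ e ∈ E.stalk (OnePoint.some a)) ↔
      ∃ f ∈ localRing (OnePoint.some a), e = f • e₁)
    (hode : E.nabla (E.nabla e₁) = -(coeffP2 σ x β • e₁) - coeffP1 σ x • E.nabla e₁)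
    (hγ : E.IsNormalization γ) (he : e₁ = γ e₁ • e₀) (he₀ : γ e₀ = 1)
    (hv0 : v ≠ 0) (hv : E.nabla e₀ = v • (-E.pCurvature p e₀)) :
    (∀ i, ordAt (x i) v = ((p : ℤ) - 1) - E.spikeOrder p (OnePoint.some (x i))) ∧
    (∀ a, OnePoint.some a ∉ marked x → ordAt a v =
      -(E.spikeOrder p (OnePoint.some a) : ℤ) - 2 * ordAt a (algebraMap k[X] (RatFunc k) U)) ∧
    (∀ a, OnePoint.some a ∉ marked x → 0 < E.spikeOrder p (OnePoint.some a) →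
      OnePoint.some a ∈ σ.M) := by
  have hu := hsol.algebraMap_ne_zero
  have hQ : funQ σ x ≠ 0 := funQ_ne_zero
  have hG := hsol.active
  have hmul := coeff_mul_eq_neg_one hsol hact hnil hL hgen hode hγ he he₀ hv
  obtain ⟨c, hc, hcw⟩ := exists_apply_eq_const_mul hsol hact hnil hL hgen hode hγ
  have hw := hγ.apply_ne_zero hL (hgen 0)
  have hordw : ∀ a, ordAt a (γ e₁) = ordAt a (algebraMap k[X] (RatFunc k) U) := by
    intro a
    rw [hcw, ordAt_mul a (by rwa [Ne, map_eq_zero]) hu, ordAt_const hc, zero_add]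
  have hord : ∀ a, ordAt a v + (ordAt a (funQ σ x) +
      2 * ordAt a (algebraMap k[X] (RatFunc k) U)) +
      ordAt a ((ddt : Derivation k (RatFunc k) (RatFunc k))^[p - 1]
        (funQ σ x * algebraMap k[X] (RatFunc k) U ^ 2)⁻¹) = 0 := by
    intro a
    have hm := mul_ne_zero hQ (pow_ne_zero 2 hu)
    have h1 := congrArg (ordAt a) hmul
    rw [ordAt_mul a (mul_ne_zero hv0 hm) hG, ordAt_mul a hv0 hm, ordAt_mul a hQ (pow_ne_zero 2 hu),
      ordAt_pow a hu, ordAt_neg_one] at h1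
    exact_mod_cast h1
  have hspike : ∀ a, E.spikeOrder p (OnePoint.some a) =
      (((p : ℤ) - 1) * ordAt a (logCoeff (marked x) (OnePoint.some a)) -
        (ordAt a v + 2 * ordAt a (algebraMap k[X] (RatFunc k) U))).toNat := by
    intro a
    have hθ := FlatBundle.logCoeff_ne_zero (S := marked x) a
    have hvw := mul_ne_zero hv0 (pow_ne_zero 2 hw)
    rw [FlatBundle.spikeOrder_eq_toNat p hnil hγ hL (hgen a) he hv0 hv,
      ordAt_mul a (pow_ne_zero _ hθ) (inv_ne_zero hvw), ordAt_inv, ordAt_pow a hθ,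
      ordAt_mul a hv0 (pow_ne_zero 2 hw), ordAt_pow a hw, hordw,
      Nat.cast_sub hp.out.one_le]
    rfl
  have hunm : ∀ a, OnePoint.some a ∉ marked x → ordAt a v =
      -(E.spikeOrder p (OnePoint.some a) : ℤ) -
        2 * ordAt a (algebraMap k[X] (RatFunc k) U) := by
    intro a ha
    have h1 := FlatBundle.ordAt_nonneg_of_notMem p hnil hγ hL (hgen a) he hv0 hv ha
    have h2 := hspike a
    have hvw := mul_ne_zero hv0 (pow_ne_zero 2 hw)
    rw [FlatBundle.logCoeff_of_notMem ha, one_pow, one_mul, ordAt_inv,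
      ordAt_mul a hv0 (pow_ne_zero 2 hw), ordAt_pow a hw, hordw] at h1
    rw [FlatBundle.logCoeff_of_notMem ha, ordAt_one] at h2
    push_cast at h1
    omega
  refine ⟨fun i => ?_, hunm, fun a ha hpos => ?_⟩
  · have h1 := hord (x i)
    have h2 := hspike (x i)
    have h3 : ordAt (x i) (funQ σ x) = 1 - (σ.alpha (OnePoint.some (x i)) : ℤ) :=
      ordAt_prod_zpow_apply hsol.injective _ (Finset.mem_univ i)
    rw [h3, hsol.ordAt_eq_zero (hsol.mem_M i), hsol.ord_marked i] at h1
    rw [FlatBundle.logCoeff_of_mem (mem_marked_some.2 ⟨i, rfl⟩), ordAt_X_sub_C_self,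
      hsol.ordAt_eq_zero (hsol.mem_M i)] at h2
    omega
  · by_contra haM
    have h1 := hord a
    have h3 : ordAt a (funQ σ x) = 0 :=
      ordAt_prod_zpow_of_ne _ fun i _ h => ha (mem_marked_some.2 ⟨i, h⟩)
    rw [h3, hsol.ord_else a haM] at h1
    have := hunm a ha
    omega

/-- Up to a constant, `v⁻¹` is the radicand divided by the `(p - 1)`-st power of the
denominator of the form: both sides have the same orders at all finite points. -/
theorem exists_inv_coeff_eq (hsol : IsStrongSolution σ x β U) (hact : E.IsActive p)
    (hnil : E.IsNilpotent p) (hL : E.IsHodgeFiltration L)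
    (hgen : ∀ a : k, ∀ e : V, (e ∈ L ∧ e ∈ E.stalk (OnePoint.some a)) ↔
      ∃ f ∈ localRing (OnePoint.some a), e = f • e₁)
    (hode : E.nabla (E.nabla e₁) = -(coeffP2 σ x β • e₁) - coeffP1 σ x • E.nabla e₁)
    (hγ : E.IsNormalization γ) (he : e₁ = γ e₁ • e₀) (he₀ : γ e₀ = 1)
    (hv0 : v ≠ 0) (hv : E.nabla e₀ = v • (-E.pCurvature p e₀)) {spk : Finset k}
    (hspk : ∀ b, b ∈ spk ↔ OnePoint.some b ∉ marked x ∧ 0 < E.spikeOrder p (OnePoint.some b)) :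
    ∃ ε : k, ε ≠ 0 ∧ RatFunc.C (ε ^ (p - 1)) * radicand p x E spk U * v =
      formDenom p x E spk ^ (p - 1) := by
  obtain ⟨hm, hu, -⟩ := ordAt_coeff hsol hact hnil hL hgen hode hγ he he₀ hv0 hv
  have hrad := radicand_ne_zero (p := p) hsol E spk
  have hfd := formDenom_ne_zero p E spk
  have hf := hsol.algebraMap_ne_zero
  have hp1 : 0 < p - 1 := by have := hp.out.two_le; omega
  set q : RatFunc k := formDenom p x E spk ^ (p - 1) * (radicand p x E spk U * v)⁻¹ with hq
  have hrv := mul_ne_zero hrad hv0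
  have hq0 : q ≠ 0 := mul_ne_zero (pow_ne_zero _ hfd) (inv_ne_zero hrv)
  have hrad' : radicand p x E spk U =
      (∏ i, (RatFunc.X - RatFunc.C (x i)) ^
        ((E.spikeOrder p (OnePoint.some (x i)) % (p - 1) : ℕ) : ℤ)) *
      (∏ b ∈ spk, (RatFunc.X - RatFunc.C b) ^
        ((E.spikeOrder p (OnePoint.some b) % (p - 1) : ℕ) : ℤ)) *
      algebraMap k[X] (RatFunc k) U ^ 2 := by
    unfold radicand
    simp only [zpow_natCast]
  -- with `n` the order of the `p`-curvature, this is `n = (p - 1) (n / (p - 1)) + n % (p - 1)`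
  have hordq : ∀ a, ordAt a q = 0 := by
    intro a
    have hordq' : ordAt a q = ((p - 1 : ℕ) : ℤ) * ordAt a (formDenom p x E spk) -
        (ordAt a (radicand p x E spk U) + ordAt a v) := by
      rw [hq, ordAt_mul a (pow_ne_zero _ hfd) (inv_ne_zero hrv), ordAt_inv, ordAt_pow a hfd,
        ordAt_mul a hrad hv0]
      ring
    have hordrad : ordAt a (radicand p x E spk U) =
        ordAt a (∏ i, (RatFunc.X - RatFunc.C (x i) : RatFunc k) ^
          ((E.spikeOrder p (OnePoint.some (x i)) % (p - 1) : ℕ) : ℤ)) +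
        ordAt a (∏ b ∈ spk, (RatFunc.X - RatFunc.C b : RatFunc k) ^
          ((E.spikeOrder p (OnePoint.some b) % (p - 1) : ℕ) : ℤ)) +
        (2 : ℕ) * ordAt a (algebraMap k[X] (RatFunc k) U) := by
      rw [hrad', ordAt_mul a (mul_ne_zero (prod_zpow_ne_zero _ x _)
        (prod_zpow_ne_zero spk (fun b => b) _)) (pow_ne_zero 2 hf),
        ordAt_mul a (prod_zpow_ne_zero _ x _) (prod_zpow_ne_zero spk (fun b => b) _),
        ordAt_pow a hf]
    have hordfd : ordAt a (formDenom p x E spk) =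
        ordAt a (∏ i, (RatFunc.X - RatFunc.C (x i) : RatFunc k) ^
          (1 - ((E.spikeOrder p (OnePoint.some (x i)) / (p - 1) : ℕ) : ℤ))) +
        ordAt a (∏ b ∈ spk, (RatFunc.X - RatFunc.C b : RatFunc k) ^
          (1 - ((1 + E.spikeOrder p (OnePoint.some b) / (p - 1) : ℕ) : ℤ))) :=
      ordAt_mul a (prod_zpow_ne_zero _ x _) (prod_zpow_ne_zero spk (fun b => b) _)
    have hdm := Nat.div_add_mod (E.spikeOrder p (OnePoint.some a)) (p - 1)
    have hdm' : ((p - 1 : ℕ) : ℤ) * ((E.spikeOrder p (OnePoint.some a) / (p - 1) : ℕ) : ℤ) +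
        ((E.spikeOrder p (OnePoint.some a) % (p - 1) : ℕ) : ℤ) =
        (E.spikeOrder p (OnePoint.some a) : ℤ) := by exact_mod_cast hdm
    have hpc : ((p - 1 : ℕ) : ℤ) = (p : ℤ) - 1 := by
      rw [Nat.cast_sub hp.out.one_le, Nat.cast_one]
    by_cases ha : OnePoint.some a ∈ marked x
    · obtain ⟨i, rfl⟩ := mem_marked_some.1 ha
      have hns : ∀ b ∈ spk, x i ≠ b := by
        intro b hb h
        exact ((hspk b).1 hb).1 (by rw [← h]; exact ha)
      rw [ordAt_prod_zpow_apply hsol.injective _ (Finset.mem_univ i),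
        ordAt_prod_zpow_of_ne (x := fun b => b) _ hns, hsol.ordAt_eq_zero (hsol.mem_M i)] at hordrad
      rw [ordAt_prod_zpow_apply hsol.injective _ (Finset.mem_univ i),
        ordAt_prod_zpow_of_ne (x := fun b => b) _ hns] at hordfd
      rw [hordq', hordrad, hordfd, hm i]
      linear_combination (-1 : ℤ) * hdm' + hpc
    · have hnm : ∀ i ∈ (Finset.univ : Finset (Fin (r - 1))), a ≠ x i :=
        fun i _ h => ha (mem_marked_some.2 ⟨i, h⟩)
      have hua := hu a ha
      by_cases has : a ∈ spk
      · rw [ordAt_prod_zpow_of_ne _ hnm,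
          ordAt_prod_zpow_apply (x := fun b => b) (j := a) (fun _ _ h => h) _ has] at hordrad hordfd
        rw [hordq', hordrad, hordfd, hua]
        push_cast at hdm' ⊢
        linear_combination (-1 : ℤ) * hdm'
      · have hn0 : E.spikeOrder p (OnePoint.some a) = 0 := by
          by_contra hne
          exact has ((hspk a).2 ⟨ha, Nat.pos_of_ne_zero hne⟩)
        have hns : ∀ b ∈ spk, a ≠ b := by
          rintro b hb rfl
          exact has hb
        rw [ordAt_prod_zpow_of_ne _ hnm,
          ordAt_prod_zpow_of_ne (x := fun b => b) _ hns] at hordrad hordfd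
        rw [hordq', hordrad, hordfd, hua, hn0]
        push_cast
        ring
  obtain ⟨κ, hκ, hqκ⟩ := exists_const_of_ordAt_eq_zero hq0 hordq
  obtain ⟨ε, hε⟩ := IsAlgClosed.exists_pow_nat_eq κ hp1
  refine ⟨ε, ?_, ?_⟩
  · rintro rfl
    rw [zero_pow hp1.ne'] at hε
    exact hκ hε.symm
  · rw [hε, ← hqκ, hq, mul_assoc, inv_mul_cancel_right₀ hrv]

end Divisor

end AccessoryDatum
open AccessoryDatum

/-! ### The deformation data attached to the bundle -/

theorem proposition5p6 {k : Type u} [Field k] [IsAlgClosed k] (p : ℕ) [Fact p.Prime] [CharP k p]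
    (hp : p ≠ 2) {r : ℕ} (hr : 3 ≤ r) (σ : AccessoryDatum.Signature k p)
    (x : Fin (r - 1) → k) (β : Fin (r - 3) → k) (U : Polynomial k)
    (hsol : AccessoryDatum.IsStrongSolution σ x β U)
    {V : Type v} [AddCommGroup V] [Module (RatFunc k) V]
    (E : AccessoryDatum.FlatBundle (AccessoryDatum.marked x) V)
    (hind : E.IsIndigenous) (hact : E.IsActive p) (hnil : E.IsNilpotent p)
    (hnorm : E.IsNormalized)
    (L : Submodule (RatFunc k) V) (hL : E.IsHodgeFiltration L)
    (hop : E.IsAssociatedOperator L (AccessoryDatum.coeffP1 σ x) (AccessoryDatum.coeffP2 σ x β)) :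
    ∃ spk : Finset k,
      (∀ b, b ∈ spk ↔ OnePoint.some b ∉ AccessoryDatum.marked x ∧
        0 < E.spikeOrder p (OnePoint.some b)) ∧
      (∀ (F : Type w) [Field F] [Algebra k F] [Algebra (RatFunc k) F]
        [IsScalarTower k (RatFunc k) F] (z : F),
        AccessoryDatum.IsKummerCover p (AccessoryDatum.radicand p x E spk U) z →
          IsGalois (RatFunc k) F ∧ IsCyclic (F ≃ₐ[RatFunc k] F) ∧ AccessoryDatum.IsTame k F p) ∧
      ∃ ε : k, ε ≠ 0 ∧
        ∀ (F : Type w) [Field F] [Algebra k F] [Algebra (RatFunc k) F]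
          [IsScalarTower k (RatFunc k) F] (ω : Ω[F⁄k]),
          AccessoryDatum.IsAttached p E L ω ↔
            ∃ z : F, AccessoryDatum.IsKummerCover p (AccessoryDatum.radicand p x E spk U) z ∧
              ω = (algebraMap k F ε * z *
                (algebraMap (RatFunc k) F (AccessoryDatum.formDenom p x E spk))⁻¹) •
                  AccessoryDatum.dt k F := by
  classical
  obtain ⟨e₁, he₁L, hgen, hode⟩ := hop
  obtain ⟨γ, hγ⟩ := hnorm
  have hw := hγ.apply_ne_zero hL (hgen 0)
  have he₁0 : e₁ ≠ 0 := by
    rintro rfl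
    exact hw (map_zero γ)
  set e₀ := (γ e₁)⁻¹ • e₁ with he₀def
  have he₀ : γ e₀ = 1 := by
    rw [he₀def, map_smul, smul_eq_mul, inv_mul_cancel₀ hw]
  have he : e₁ = γ e₁ • e₀ := by rw [he₀def, smul_smul, mul_inv_cancel₀ hw, one_smul]
  obtain ⟨v, hv⟩ := FlatBundle.exists_nabla_eq_smul p hnil hact hγ.1 he₀
  have hmul := coeff_mul_eq_neg_one hsol hact hnil hL hgen hode hγ he he₀ hv
  have hv0 : v ≠ 0 := by
    rintro rfl
    rw [zero_mul, zero_mul] at hmul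
    exact one_ne_zero (neg_eq_zero.1 hmul.symm)
  have hvD := FlatBundle.iterate_ddt_eq_neg_one p hnil hact hγ.1 he₀ hv
  obtain ⟨-, -, hspikeM⟩ := ordAt_coeff hsol hact hnil hL hgen hode hγ he he₀ hv0 hv
  -- the unmarked spikes lie in the finite set `M`
  let spk : Finset k := (σ.M.preimage OnePoint.some OnePoint.coe_injective.injOn).filter
    fun b => OnePoint.some b ∉ marked x ∧ 0 < E.spikeOrder p (OnePoint.some b)
  have hspk : ∀ b, b ∈ spk ↔
      OnePoint.some b ∉ marked x ∧ 0 < E.spikeOrder p (OnePoint.some b) := by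
    intro b
    rw [Finset.mem_filter, Finset.mem_preimage]
    exact ⟨fun h => h.2, fun h => ⟨hspikeM b h.1 h.2, h⟩⟩
  have hrad := radicand_ne_zero (p := p) hsol E spk
  obtain ⟨ε, hε, hεv⟩ :=
    exists_inv_coeff_eq hsol hact hnil hL hgen hode hγ he he₀ hv0 hv hspk
  have hfd := formDenom_ne_zero p E spk
  refine ⟨spk, hspk, ?_, ε, hε, ?_⟩
  · intro F _ _ _ _ z hz
    exact hz.isCyclic_isTame p hrad
  intro F _ _ _ _ ω
  have hfdF : algebraMap (RatFunc k) F (formDenom p x E spk) ≠ 0 :=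
    (map_ne_zero (algebraMap (RatFunc k) F)).2 hfd
  have hεF : algebraMap k F ε ≠ 0 := (map_ne_zero (algebraMap k F)).2 hε
  have hεF' : algebraMap (RatFunc k) F (RatFunc.C (ε ^ (p - 1))) = algebraMap k F ε ^ (p - 1) := by
    rw [← RatFunc.algebraMap_eq_C, ← IsScalarTower.algebraMap_apply, map_pow]
  have hεvF := congrArg (algebraMap (RatFunc k) F) hεv
  rw [map_mul, map_mul, hεF', map_pow] at hεvF
  have hvF : algebraMap (RatFunc k) F v ≠ 0 := (map_ne_zero (algebraMap (RatFunc k) F)).2 hv0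
  -- rescaling by a constant and an element of the base field does not change the generated field
  have hscale : ∀ z : F,
      IntermediateField.adjoin (RatFunc k) {algebraMap k F ε * z *
        (algebraMap (RatFunc k) F (formDenom p x E spk))⁻¹} =
      IntermediateField.adjoin (RatFunc k) {z} := by
    intro z
    have h1 : algebraMap k F ε * z * (algebraMap (RatFunc k) F (formDenom p x E spk))⁻¹ =
        algebraMap (RatFunc k) F (RatFunc.C ε * (formDenom p x E spk)⁻¹) * z := by
      rw [map_mul, map_inv₀, ← RatFunc.algebraMap_eq_C, ← IsScalarTower.algebraMap_apply]
      ring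
    rw [h1]
    exact adjoin_algebraMap_mul
      (mul_ne_zero ((_root_.map_ne_zero RatFunc.C).2 hε) (inv_ne_zero hfd)) z
  constructor
  · rintro ⟨hdat, γ', e₀', v', ζ, hγ', he₀'L, he₀', hv', rfl, hζ⟩
    have hw' := hγ'.apply_ne_zero hL (hgen 0)
    obtain ⟨c, hc⟩ := (finrank_eq_one_iff_of_nonzero' (⟨e₁, he₁L⟩ : L)
      (fun h => he₁0 (congrArg Subtype.val h))).1 hL.1 ⟨e₀', he₀'L⟩
    have hc' : c • e₁ = e₀' := congrArg Subtype.val hc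
    have he' : e₁ = γ' e₁ • e₀' := by
      have h1 : c * γ' e₁ = 1 := by rw [← he₀', ← hc', map_smul, smul_eq_mul]
      rw [← hc', smul_smul, mul_comm, h1, one_smul]
    -- the coefficient does not depend on the normalization
    have hvv : v' = v := by
      have h1 := coeff_mul_eq_neg_one hsol hact hnil hL hgen hode hγ' he' he₀' hv'
      rw [← hmul] at h1
      exact mul_right_cancel₀
        (mul_ne_zero funQ_ne_zero (pow_ne_zero 2 hsol.algebraMap_ne_zero))
        (mul_right_cancel₀ hsol.active h1)
    subst hvv
    set z : F := (algebraMap k F ε)⁻¹ * ζ * algebraMap (RatFunc k) F (formDenom p x E spk) with hz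
    have hzζ : algebraMap k F ε * z * (algebraMap (RatFunc k) F (formDenom p x E spk))⁻¹ = ζ := by
      rw [hz]
      field_simp
    refine ⟨z, ⟨?_, ?_⟩, by rw [hzζ]⟩
    · rw [← hscale, hzζ]
      exact hdat.adjoin_eq_top
    · apply mul_left_cancel₀ (mul_ne_zero (pow_ne_zero (p - 1) hεF) hvF)
      rw [← hzζ, mul_pow, mul_pow, inv_pow] at hζ
      have hfdp := pow_ne_zero (p - 1) hfdF
      field_simp at hζ
      linear_combination hζ - hεvF
  · rintro ⟨z, ⟨hz, hzf⟩, rfl⟩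
    set ζ : F := algebraMap k F ε * z *
      (algebraMap (RatFunc k) F (formDenom p x E spk))⁻¹ with hζdef
    have hζ : ζ ^ (p - 1) * algebraMap (RatFunc k) F v = 1 := by
      rw [hζdef, mul_pow, mul_pow, inv_pow, hzf]
      have hfdp := pow_ne_zero (p - 1) hfdF
      field_simp
      linear_combination hεvF
    refine ⟨isDeformationDatum_of_adjoin_eq_top p ((hscale z).trans hz) hζ hvD,
      γ, e₀, v, ζ, hγ, L.smul_mem _ he₁L, he₀, hv, rfl, hζ⟩
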